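/- Let $d\in\mathbb N$, $S=\mathbb Z^d$, let $(E,\mathcal E)$ be a standard Borel space, $\Omega=E^{S}$ with product $\sigma$-algebra $\mathcal F$, and for $\Lambda\subset S$ let $\mathcal F_\Lambda$ be the $\sigma$-algebra generated by the coordinates in $\Lambda$. Write $\mathcal S$ for the set of finite subsets of $S$, $\Delta_n=\{-n,\dots,n\}^d$, $(\theta_x\omega)_y=\omega_{y+x}$ and $\theta_x\Lambda=\Lambda+x$. A random field is a probability measure on $(\Omega,\mathcal F)$; it is shift-invariant if $\mu(\theta A)=\mu(A)$ for all shifts $\theta$ and all $A\in\mathcal F$. Let $\lambda$ be a probability measure on $E$ and let $\Phi=(\Phi_A)_{A\in\mathcal S}$ be an interaction potential: each $\Phi_A:\Omega\to\mathbb R\cup\{\infty\}$ is $\mathcal F_A$-measurable. Assume that $\Phi$ is shift-invariant ($\Phi_{\theta A}(\omega)=\Phi_A(\theta\omega)$) and absolutely summable ($\sum_{A\in\mathcal S,\,0\in A}\|\Phi_A\|_\infty<\infty$, with the supremum norm). Put $H_\Lambda=\sum_{A\in\mathcal S,\,A\cap\Lambda\ne\varnothing}\Phi_A$, $\varepsilon_{\Lambda,\Delta}=\sum_{A\in\mathcal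 S,\,A\cap\Lambda\neq\varnothing,\,A\not\subset\Delta}\|\Phi_A\|_\infty$, and let $\gamma=(\gamma_\Lambda)_{\Lambda\in\mathcal S}$ be given by $$\gamma_\Lambda(A,\omega)=\frac1{Z_\Lambda^\omega}\int_{E^\Lambda}1_A(\zeta\omega_{S\setminus\Lambda})\,e^{-H_\Lambda(\zeta\omega_{S\setminus\Lambda})}\,d\lambda^\Lambda(\zeta),\qquad Z_\Lambda^\omega=\int_{E^\Lambda}e^{-H_\Lambda(\zeta\omega_{S\setminus\Lambda})}\,d\lambda^\Lambda(\zeta).$$ Notation. $\hat\gamma_\Lambda(\cdot,\omega)$ is the marginal of $\gamma_\Lambda(\cdot,\omega)$ on $E^\Lambda$. $\mathcal B_\Lambda=\{\mu\hat\gamma_\Lambda:\mu\text{ a random field}\}$, and $\mathcal B_{\Lambda,\Delta,\omega}$ is the set of those $\mu\hat\gamma_\Lambda$ for which the marginal of $\mu$ on $E^\Delta$ is the Dirac mass at $\omega_\Delta$. $\mathcal C(\mathcal B)$ is the closure of $\mathcal B$ in the strong topology (the coarsest topology making $\mu\mapsto\mu(A)$ continuous for every measurable $A$). $\mathcal H^\infty(\mu|\nu)=\log\inf\{c\ge0:\mu\le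 c\nu\}$ and $\operatorname{Diam}^\infty\mathcal B=\sup_{\mu,\nu\in\mathcal B}\mathcal H^\infty(\mu|\nu)$. $\Omega_\gamma$ is the set of $\omega\in\Omega$ with $\bigcap_{\Delta\in\mathcal S}\mathcal C(\mathcal B_{\Lambda,\Delta,\omega})=\{\hat\gamma_\Lambda(\cdot,\omega)\}$ for every $\Lambda\in\mathcal S$. $\mathcal H_\Lambda(\mu|\nu)$ is the relative entropy of the restrictions of $\mu$ and $\nu$ to $\mathcal F_\Lambda$. Then: 1. $\operatorname{Diam}^\infty\mathcal C(\mathcal B_{\Lambda,\Delta,\omega})\le4\varepsilon_{\Lambda,\Delta}$ for all $\Lambda,\Delta\in\mathcal S$ and $\omega\in\Omega$. 2. $\gamma$ is a weakly dependent specification, that is: every $\gamma_\Lambda$ is a probability kernel from $(\Omega,\mathcal F_{S\setminus\Lambda})$ to $(\Omega,\mathcal F)$; it is proper ($\gamma_\Lambda(A,\omega)=1_A(\omega)$ for $A\in\mathcal F_{S\setminus\Lambda}$); the family is consistent ($\gamma_\Delta\gamma_\Lambda=\gamma_\Delta$ for $\Lambda\subset\Delta\in\mathcal S$) and shift-invariant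 ($\gamma_{\theta\Lambda}(A,\omega)=\gamma_\Lambda(\theta A,\theta\omega)$); $\operatorname{Diam}^\infty\mathcal B_{\Delta_n}=o(|\Delta_n|)$ as $n\to\infty$; and $\operatorname{Diam}^\infty\mathcal B_\Lambda<\infty$ for every $\Lambda\in\mathcal S$. 3. $\gamma$ is continuous everywhere: $\Omega_\gamma=\Omega$. 4. For every shift-invariant random field $\mu$ the specific free energy $$h(\mu|\gamma)=\lim_{n\to\infty}|\Delta_n|^{-1}\,\mathcal H_{\Delta_n}(\mu|\nu\gamma_{\Delta_n})\in[0,\infty]$$ exists for every random field $\nu$ and does not depend on $\nu$; and the minimizers, i.e. the shift-invariant random fields $\mu$ with $h(\mu|\gamma)=0$, are exactly the shift-invariant Gibbs measures, i.e. the shift-invariant random fields $\mu$ with $\mu\gamma_\Lambda=\mu$ for every $\Lambda\in\mathcal S$. -/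

import Mathlib

open MeasureTheory Filter Topology
open scoped ENNReal NNReal

noncomputable section

namespace RandomField

/-! ### Configurations and shifts -/

/-- Sites: the lattice `ℤ^d`. -/
abbrev Site (d : ℕ) : Type := Fin d → ℤ

/-- Configurations `Ω = E^{ℤ^d}`, with the product σ-algebra. -/
abbrev Config (d : ℕ) (E : Type*) : Type _ := Site d → E

variable {d : ℕ} {E : Type*}

/-- The shifted configuration, `(θ_x ω)_y = ω_{y + x}`. -/
def shift (x : Site d) (ω : Config d E) : Config d E := fun y => ω (y + x)

/-- The shifted set of sites, `θ_x Λ = Λ + x`. -/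
def shiftSites (x : Site d) (Λ : Finset (Site d)) : Finset (Site d) := Λ.image (· + x)

/-- The box `Δ_n = {-n, …, n}^d`. -/
def box (d n : ℕ) : Finset (Site d) := Fintype.piFinset fun _ => Finset.Icc (-(n : ℤ)) (n : ℤ)

/-- The configuration `ζ ω_{Λᶜ}`: equal to `ζ` on `Λ` and to `ω` off `Λ`. -/
def glue (Λ : Finset (Site d)) (ζ : Λ → E) (ω : Config d E) : Config d E :=
  fun x => if h : x ∈ Λ then ζ ⟨x, h⟩ else ω x

/-! ### Max-entropy, max-diameter, strong topology -/

section Measures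

variable {X : Type*} [MeasurableSpace X]

/-- The max-entropy `log inf {c ≥ 0 : μ ≤ c ν}` (with `inf ∅ = ∞`, `log 0 = -∞`, `log ∞ = ∞`). -/
def maxEntropy (μ ν : Measure X) : EReal :=
  ENNReal.log (⨅ (c : ℝ≥0) (_ : μ ≤ c • ν), (c : ℝ≥0∞))

/-- The max-diameter of a set of measures. -/
def maxDiam (B : Set (Measure X)) : EReal :=
  ⨆ (μ ∈ B) (ν ∈ B), maxEntropy μ ν

/-- The strong topology on measures: the coarsest one for which `μ ↦ μ A` is continuous for every
measurable `A`. -/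
abbrev strongTopology (X : Type*) [MeasurableSpace X] : TopologicalSpace (Measure X) :=
  ⨅ (A : Set X) (_ : MeasurableSet A), TopologicalSpace.induced (fun μ : Measure X => μ A)
    inferInstance

/-- The closure `C(B)` of a set of measures in the strong topology. (Limits of probability measures
have total mass one, so for sets of probability measures it is irrelevant in which of the usual
spaces of measures the closure is taken.) -/
def strongClosure (B : Set (Measure X)) : Set (Measure X) :=
  @closure _ (strongTopology X) B

end Measures

variable [MeasurableSpace E]

/-- Shift-invariance of a random field: `μ(θA) = μ(A)`. -/
def IsShiftInvariant (μ : Measure (Config d E)) : Prop :=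
  ∀ (x : Site d) (A : Set (Config d E)), MeasurableSet A → μ (shift x '' A) = μ A

/-! ### Specifications -/

/-- A specification: a family of probability kernels `γ_Λ` from `(Ω, F_{Λᶜ})` to `(Ω, F)`, which is
proper and consistent. `cylinderEvents T` is the σ-algebra generated by the states at sites in `T`;
`Measure.bind μ (γ Λ)` is `μ γ_Λ`. -/
structure IsSpecification (γ : Finset (Site d) → Config d E → Measure (Config d E)) : Prop where
  isProbabilityMeasure : ∀ Λ ω, IsProbabilityMeasure (γ Λ ω)
  measurable : ∀ (Λ : Finset (Site d)) (A : Set (Config d E)), MeasurableSet A →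
    Measurable[cylinderEvents (X := fun _ : Site d => E) ((Λ : Set (Site d))ᶜ)]
      (fun ω => γ Λ ω A)
  proper : ∀ (Λ : Finset (Site d)) (A : Set (Config d E)),
    MeasurableSet[cylinderEvents (X := fun _ : Site d => E) ((Λ : Set (Site d))ᶜ)] A →
      ∀ ω, γ Λ ω A = A.indicator 1 ω
  consistent : ∀ Λ Δ : Finset (Site d), Λ ⊆ Δ → ∀ ω, (γ Δ ω).bind (γ Λ) = γ Δ ω

/-- Shift-invariance of a specification: `γ_{θΛ}(A, ω) = γ_Λ(θA, θω)`. -/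
def IsShiftInvariantSpec (γ : Finset (Site d) → Config d E → Measure (Config d E)) : Prop :=
  ∀ (Λ : Finset (Site d)) (x : Site d) (A : Set (Config d E)), MeasurableSet A →
    ∀ ω, γ (shiftSites x Λ) ω A = γ Λ (shift x ω) (shift x '' A)

/-- The finite-volume Gibbs measure on `E^Λ` with deterministic boundary condition `ω`. -/
def finiteVolume (γ : Finset (Site d) → Config d E → Measure (Config d E))
    (Λ : Finset (Site d)) (ω : Config d E) : Measure (Λ → E) :=
  (γ Λ ω).map Λ.restrict

/-- The set `B_Λ(γ)` of all finite-volume Gibbs measures in `Λ` with mixed boundary conditions. -/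
def finiteVolumeSet (γ : Finset (Site d) → Config d E → Measure (Config d E))
    (Λ : Finset (Site d)) : Set (Measure (Λ → E)) :=
  {ρ | ∃ μ : Measure (Config d E), IsProbabilityMeasure μ ∧ ρ = μ.bind (finiteVolume γ Λ)}

/-- The set `B_{Λ,Δ,ω}(γ)`: the boundary conditions are random fields whose marginal on `Δ` is the
Dirac mass at `ω_Δ`. -/
def finiteVolumeSetNear (γ : Finset (Site d) → Config d E → Measure (Config d E))
    (Λ Δ : Finset (Site d)) (ω : Config d E) : Set (Measure (Λ → E)) :=
  {ρ | ∃ μ : Measure (Config d E), IsProbabilityMeasure μ ∧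
    μ.map Δ.restrict = Measure.dirac (Δ.restrict ω) ∧ ρ = μ.bind (finiteVolume γ Λ)}

/-- The set `B_{Λ,ω}(γ) = ⋂_Δ C(B_{Λ,Δ,ω}(γ))`. -/
def finiteVolumeSetAt (γ : Finset (Site d) → Config d E → Measure (Config d E))
    (Λ : Finset (Site d)) (ω : Config d E) : Set (Measure (Λ → E)) :=
  ⋂ Δ : Finset (Site d), strongClosure (finiteVolumeSetNear γ Λ Δ ω)

/-- The set `Ω_γ` of configurations at which the specification is continuous (quasilocal). -/
def continuityPoints (γ : Finset (Site d) → Config d E → Measure (Config d E)) :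
    Set (Config d E) :=
  {ω | ∀ Λ : Finset (Site d), finiteVolumeSetAt γ Λ ω = {finiteVolume γ Λ ω}}

/-- Weakly dependent specifications: `Diam^∞ B_{Δ_n}(γ) = o(|Δ_n|)`, and `Diam^∞ B_Λ(γ)` is finite
for every finite `Λ`. -/
structure IsWeaklyDependent (γ : Finset (Site d) → Config d E → Measure (Config d E)) :
    Prop where
  isSpecification : IsSpecification γ
  isShiftInvariant : IsShiftInvariantSpec γ
  isLittleO : Tendsto
    (fun n : ℕ => maxDiam (finiteVolumeSet γ (box d n)) / ((box d n).card : EReal)) atTop (𝓝 0)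
  finite : ∀ Λ : Finset (Site d), maxDiam (finiteVolumeSet γ Λ) < ⊤

/-- The DLR states of `γ`: random fields `μ` with `μ γ_Λ = μ` for every finite `Λ`. They are called
Gibbs measures when `Ω_γ = Ω`. -/
def dlrStates (γ : Finset (Site d) → Config d E → Measure (Config d E)) :
    Set (Measure (Config d E)) :=
  {μ | IsProbabilityMeasure μ ∧ ∀ Λ : Finset (Site d), μ.bind (γ Λ) = μ}

/-! ### Specific free energy -/

/-- The entropy `H_Λ(μ | ν)` in the volume `Λ` of two random fields, computed from their marginals
on `E^Λ`. -/
def entropyOn (Λ : Finset (Site d)) (μ ν : Measure (Config d E)) : ℝ≥0∞ :=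
  InformationTheory.klDiv (μ.map Λ.restrict) (ν.map Λ.restrict)

/-- The specific free energy `h(μ | γ) = lim_n |Δ_n|⁻¹ H_{Δ_n}(μ | ν γ_{Δ_n})` exists, does not
depend on the random field `ν`, and equals `h`. -/
def HasSFE (γ : Finset (Site d) → Config d E → Measure (Config d E))
    (μ : Measure (Config d E)) (h : ℝ≥0∞) : Prop :=
  ∀ ν : Measure (Config d E), IsProbabilityMeasure ν →
    Tendsto (fun n : ℕ => entropyOn (box d n) μ (ν.bind (γ (box d n))) / ((box d n).card : ℝ≥0∞))
      atTop (𝓝 h)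

/-- The set `h_0(γ)` of minimizers: shift-invariant random fields with `h(μ | γ) = 0`. -/
def minimizers (γ : Finset (Site d) → Config d E → Measure (Config d E)) :
    Set (Measure (Config d E)) :=
  {μ | IsProbabilityMeasure μ ∧ IsShiftInvariant μ ∧ HasSFE γ μ 0}

/-! ### Interaction potentials and the Gibbs specification -/

/-- Interaction potentials: each `Φ_A` is `F_A`-measurable with values in `ℝ ∪ {∞}`. -/
structure IsPotential (Φ : Finset (Site d) → Config d E → EReal) : Prop where
  measurable : ∀ A : Finset (Site d),
    Measurable[cylinderEvents (X := fun _ : Site d => E) (A : Set (Site d))] (Φ A)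
  ne_bot : ∀ A ω, Φ A ω ≠ ⊥

/-- Shift-invariance of a potential: `Φ_{θA}(ω) = Φ_A(θω)`. -/
def IsShiftInvariantPotential (Φ : Finset (Site d) → Config d E → EReal) : Prop :=
  ∀ (A : Finset (Site d)) (x : Site d) (ω : Config d E), Φ (shiftSites x A) ω = Φ A (shift x ω)

/-- The supremum norm, with values in `[0, ∞]`. -/
def supNorm (f : Config d E → EReal) : ℝ≥0∞ := ⨆ ω, (f ω).abs

/-- Absolute summability: `‖Φ‖ = ∑_{A ∋ 0} ‖Φ_A‖_∞ < ∞`. -/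
def IsAbsolutelySummable (Φ : Finset (Site d) → Config d E → EReal) : Prop :=
  (∑' A : {A : Finset (Site d) // (0 : Site d) ∈ A}, supNorm (Φ A)) < ⊤

/-- The quantity `ε_{Λ,Δ}`: the sum of `‖Φ_A‖_∞` over the finite `A` with `A ∩ Λ ≠ ∅` and
`A ⊄ Δ`. -/
def interactionTail (Φ : Finset (Site d) → Config d E → EReal) (Λ Δ : Finset (Site d)) : ℝ≥0∞ :=
  ∑' A : {A : Finset (Site d) // (A ∩ Λ).Nonempty ∧ ¬ A ⊆ Δ}, supNorm (Φ A)

/-- The Hamiltonian `H_Λ`: the sum of `Φ_A` over the finite `A` with `A ∩ Λ ≠ ∅`. -/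
def hamiltonian (Φ : Finset (Site d) → Config d E → EReal) (Λ : Finset (Site d))
    (ω : Config d E) : EReal :=
  ∑' A : {A : Finset (Site d) // (A ∩ Λ).Nonempty}, Φ A ω

/-- The Boltzmann weight `exp (-H_Λ(ζ ω_{Λᶜ}))`. -/
def boltzmann (Φ : Finset (Site d) → Config d E → EReal) (Λ : Finset (Site d))
    (ω : Config d E) (ζ : Λ → E) : ℝ≥0∞ :=
  EReal.exp (-hamiltonian Φ Λ (glue Λ ζ ω))

/-- The normalizing constant `Z_Λ^ω = ∫ exp (-H_Λ(ζ ω_{Λᶜ})) dρ^Λ(ζ)`. -/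
def partitionFunction (ρ : Measure E) (Φ : Finset (Site d) → Config d E → EReal)
    (Λ : Finset (Site d)) (ω : Config d E) : ℝ≥0∞ :=
  ∫⁻ ζ, boltzmann Φ Λ ω ζ ∂(Measure.pi fun _ : Λ => ρ)

/-- The Gibbs specification generated by the reference measure `ρ` and the potential `Φ`:
`γ_Λ(A, ω) = (Z_Λ^ω)⁻¹ ∫ 1_A(ζ ω_{Λᶜ}) exp (-H_Λ(ζ ω_{Λᶜ})) dρ^Λ(ζ)`. -/
def gibbsSpecification (ρ : Measure E) (Φ : Finset (Site d) → Config d E → EReal)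
    (Λ : Finset (Site d)) (ω : Config d E) : Measure (Config d E) :=
  (partitionFunction ρ Φ Λ ω)⁻¹ •
    (((Measure.pi fun _ : Λ => ρ).withDensity (boltzmann Φ Λ ω)).map (fun ζ => glue Λ ζ ω))

end RandomField

end

/-! Two estimates carry the theorem. The first concerns boundary conditions. If two of them agree on
Δ \ Λ, then H_Λ changes by at most 2ε_{Λ,Δ}, because only the sets A not contained in Δ can see the
difference. The unnormalised density and the normalising constant each move by a factor of at most
exp(2ε_{Λ,Δ}), so the finite-volume measures dominate one another up to exp(4ε_{Λ,Δ})
(`expDominated_finiteVolume`). Domination survives averaging over boundary conditions and strong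
closure, whence the diameter bound. Since ε_{Λ,Δ} → 0 as Δ exhausts the lattice, the intersection of
the closures is a single point; since ε_{Δ_n,Δ_n} = o(|Δ_n|), weak dependence follows.

The second is an approximate superadditivity of the entropy. Domination up to exp(D) costs at most D
in relative entropy (`klDiv_le_klDiv_add`), so γ_B can be replaced by a kernel that looks only at a
finite volume W, and for that kernel the chain rule is exact. If W and B are disjoint and νγ_B = ν,
this yields (`entropyOn_add_entropyOn_bind_le`) H_W(μ|ν) + H_{W∪B}(μ|μγ_B) ≤ H_{W∪B}(μ|ν) +
8ε_{B,W∪B}. Packing Δ_n with disjoint translates of Δ_m ⊇ B and taking ν = μγ_{Δ_n} gives, for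
shift-invariant μ (`entropyOn_div_card_le_liminf`), H_{Δ_m}(μ|μγ_B) ≤ |Δ_m| liminf_n |Δ_n|⁻¹
H_{Δ_n}(μ|μγ_{Δ_n}) + 8ε_{B,Δ_m}. With B = Δ_m this bounds the limsup by the liminf, so the specific
free energy exists. With B = Λ fixed and zero free energy, the right side tends to 0 as m → ∞, which
forces μγ_Λ = μ. Conversely, for a Gibbs measure the choice ν = μ makes every entropy vanish. -/

noncomputable section

namespace RandomField

/-! ### Relative entropy -/

section Entropy

open InformationTheory ProbabilityTheory

variable {X Y : Type*} [MeasurableSpace X] [MeasurableSpace Y]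

/-- Domination of measures up to the factor `exp D`. -/
def ExpDominated (D : ℝ≥0) (μ ν : Measure X) : Prop :=
  ∀ A : Set X, MeasurableSet A → μ A ≤ ENNReal.ofReal (Real.exp D) * ν A

theorem ExpDominated.le {D : ℝ≥0} {μ ν : Measure X} (h : ExpDominated D μ ν) :
    μ ≤ ENNReal.ofReal (Real.exp D) • ν :=
  Measure.le_iff.2 fun A hA => by simpa using h A hA

theorem ExpDominated.absolutelyContinuous {D : ℝ≥0} {μ ν : Measure X}
    (h : ExpDominated D μ ν) : μ ≪ ν :=
  Measure.AbsolutelyContinuous.mk fun A hA h0 => by simpa [h0] using h A hA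

theorem ExpDominated.map {D : ℝ≥0} {μ ν : Measure X} (h : ExpDominated D μ ν) {f : X → Y}
    (hf : Measurable f) : ExpDominated D (μ.map f) (ν.map f) := fun A hA => by
  rw [Measure.map_apply hf hA, Measure.map_apply hf hA]
  exact h _ (hf hA)

theorem ExpDominated.rnDeriv_le {D : ℝ≥0} {μ ν : Measure X} [IsFiniteMeasure μ]
    [IsFiniteMeasure ν] (h : ExpDominated D μ ν) :
    ∀ᵐ x ∂ν, μ.rnDeriv ν x ≤ ENNReal.ofReal (Real.exp D) := by
  refine ae_le_of_forall_setLIntegral_le_of_sigmaFinite (Measure.measurable_rnDeriv _ _)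
    fun s hs _ => ?_
  rw [Measure.setLIntegral_rnDeriv h.absolutelyContinuous, setLIntegral_const]
  exact h s hs

/-- With h = dμ/dν₂ and g = dν₂/dν₁, the two sides differ by hg(D − log g) when h and g are
positive. The extra terms g and 1 avoid subtraction; both integrate to 1 against ν₁ and then cancel.
-/
theorem klFun_mul_le {h g D : ℝ} (hh : 0 ≤ h) (hg : 0 ≤ g) (hgD : g ≤ Real.exp D) :
    klFun (h * g) + g ≤ g * klFun h + D * (h * g) + 1 := by
  rcases hg.eq_or_lt with rfl | hg
  · simp [klFun_zero]
  rcases hh.eq_or_lt with rfl | hh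
  · simp [klFun_zero]
    linarith
  have hlog : Real.log g ≤ D := (Real.log_le_iff_le_exp hg).2 hgD
  rw [klFun_apply, klFun_apply, Real.log_mul hh.ne' hg.ne']
  nlinarith [mul_le_mul_of_nonneg_left hlog (mul_pos hh hg).le]

/-- Replacing the reference measure by one dominating it changes the relative entropy by at most
the logarithm of the domination constant. -/
theorem klDiv_le_klDiv_add {D : ℝ≥0} {μ ν₁ ν₂ : Measure X} [IsProbabilityMeasure μ]
    [IsProbabilityMeasure ν₁] [IsProbabilityMeasure ν₂] (h : ExpDominated D ν₂ ν₁) :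
    klDiv μ ν₁ ≤ klDiv μ ν₂ + D := by
  by_cases hac : μ ≪ ν₂
  swap
  · simp [klDiv_of_not_ac hac]
  have hac₁ := hac.trans h.absolutelyContinuous
  rw [klDiv_eq_lintegral_klFun_of_ac hac, klDiv_eq_lintegral_klFun_of_ac hac₁]
  have key : ∀ᵐ x ∂ν₁, ENNReal.ofReal (klFun (μ.rnDeriv ν₁ x).toReal) + ν₂.rnDeriv ν₁ x ≤
      ν₂.rnDeriv ν₁ x * ENNReal.ofReal (klFun (μ.rnDeriv ν₂ x).toReal)
        + D * μ.rnDeriv ν₁ x + 1 := by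
    filter_upwards [h.rnDeriv_le, Measure.rnDeriv_mul_rnDeriv (κ := ν₁) hac,
      Measure.rnDeriv_lt_top μ ν₁] with x h1 h2 h3
    simp only [Pi.mul_apply] at h2
    rw [← h2] at h3 ⊢
    have hg : ν₂.rnDeriv ν₁ x ≠ ⊤ := ne_top_of_le_ne_top ENNReal.ofReal_ne_top h1
    -- Where dν₂/dν₁ vanishes, dμ/dν₂ may be infinite, but both sides then reduce to 1.
    rcases eq_or_ne (ν₂.rnDeriv ν₁ x) 0 with h0 | h0
    · simp [h0, klFun_zero]
    have hh : μ.rnDeriv ν₂ x ≠ ⊤ := fun hh => by simp [hh, h0] at h3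
    lift μ.rnDeriv ν₂ x to ℝ≥0 using hh with a
    lift ν₂.rnDeriv ν₁ x to ℝ≥0 using hg with b
    have hb : (b : ℝ) ≤ Real.exp D := by
      simpa using (ENNReal.le_ofReal_iff_toReal_le (by simp) (Real.exp_pos _).le).1 h1
    have := ENNReal.ofReal_le_ofReal (klFun_mul_le (D := D) a.coe_nonneg b.coe_nonneg hb)
    have ha := klFun_nonneg a.coe_nonneg
    rw [ENNReal.ofReal_add (klFun_nonneg (mul_nonneg a.coe_nonneg b.coe_nonneg)) b.coe_nonneg,
      ENNReal.ofReal_add (add_nonneg (mul_nonneg b.coe_nonneg ha)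
        (mul_nonneg D.coe_nonneg (mul_nonneg a.coe_nonneg b.coe_nonneg))) zero_le_one,
      ENNReal.ofReal_add (mul_nonneg b.coe_nonneg ha)
        (mul_nonneg D.coe_nonneg (mul_nonneg a.coe_nonneg b.coe_nonneg)),
      ENNReal.ofReal_mul b.coe_nonneg, ENNReal.ofReal_mul D.coe_nonneg, ENNReal.ofReal_mul a.coe_nonneg] at this
    simpa using this
  have hm : Measurable fun x => ENNReal.ofReal (klFun (μ.rnDeriv ν₂ x).toReal) := by fun_prop
  have := lintegral_mono_ae key
  rw [lintegral_add_right _ (Measure.measurable_rnDeriv _ _),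
    lintegral_add_right _ measurable_const,
    lintegral_add_right _ ((Measure.measurable_rnDeriv _ _).const_mul _),
    lintegral_rnDeriv_mul h.absolutelyContinuous hm.aemeasurable,
    lintegral_const_mul _ (Measure.measurable_rnDeriv _ _),
    Measure.lintegral_rnDeriv h.absolutelyContinuous, Measure.lintegral_rnDeriv hac₁] at this
  simpa using this

/-- Chain rule for the relative entropy with respect to a composition-product. -/
theorem klDiv_compProd_right [StandardBorelSpace Y] [Nonempty Y]
    (π : Measure (X × Y)) [IsProbabilityMeasure π] (ν : Measure X) [IsProbabilityMeasure ν]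
    (κ : Kernel X Y) [IsMarkovKernel κ] :
    klDiv π (ν ⊗ₘ κ) = klDiv π.fst ν + klDiv π (π.fst ⊗ₘ κ) := by
  -- Disintegrating π along its first marginal makes it a composition-product too.
  have h := klDiv_compProd_eq_add π.fst ν π.condKernel κ
  rwa [Measure.disintegrate] at h

end Entropy

variable {d : ℕ} {E : Type*}

/-! ### Shifts, boxes and summation over interactions -/

section Sites

theorem shift_zero (ω : Config d E) : shift 0 ω = ω := by
  funext y; simp [shift]

theorem shift_shift (x y : Site d) (ω : Config d E) : shift x (shift y ω) = shift (x + y) ω := by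
  funext z; simp [shift, add_assoc]

theorem shift_neg_shift (x : Site d) (ω : Config d E) : shift (-x) (shift x ω) = ω := by
  rw [shift_shift, neg_add_cancel, shift_zero]

theorem shift_shift_neg (x : Site d) (ω : Config d E) : shift x (shift (-x) ω) = ω := by
  rw [shift_shift, add_neg_cancel, shift_zero]

theorem shift_surjective (x : Site d) : Function.Surjective (shift (E := E) x) :=
  fun ω => ⟨shift (-x) ω, shift_shift_neg x ω⟩

theorem shift_image_eq_preimage (x : Site d) (A : Set (Config d E)) :
    shift x '' A = shift (-x) ⁻¹' A :=
  Set.image_eq_preimage_of_inverse (shift_neg_shift x) (shift_shift_neg x) |> fun h => congrFun h A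

theorem mem_shiftSites {x y : Site d} {Λ : Finset (Site d)} : y ∈ shiftSites x Λ ↔ y - x ∈ Λ := by
  simp only [shiftSites, Finset.mem_image]
  exact ⟨by rintro ⟨z, hz, rfl⟩; simpa using hz, fun h => ⟨_, h, by simp⟩⟩

theorem add_mem_shiftSites {x y : Site d} {Λ : Finset (Site d)} :
    y + x ∈ shiftSites x Λ ↔ y ∈ Λ := by
  simp [mem_shiftSites]

theorem shiftSites_zero (Λ : Finset (Site d)) : shiftSites 0 Λ = Λ := by
  ext; simp [mem_shiftSites]

theorem shiftSites_shiftSites (x y : Site d) (Λ : Finset (Site d)) :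
    shiftSites x (shiftSites y Λ) = shiftSites (x + y) Λ := by
  ext; simp [mem_shiftSites, sub_sub]

theorem card_shiftSites (x : Site d) (Λ : Finset (Site d)) : (shiftSites x Λ).card = Λ.card :=
  Finset.card_image_of_injective _ (add_left_injective x)

theorem shiftSites_subset_iff {x : Site d} {Λ Δ : Finset (Site d)} :
    shiftSites x Λ ⊆ shiftSites x Δ ↔ Λ ⊆ Δ :=
  Finset.image_subset_image_iff (add_left_injective x)

theorem shiftSites_inter (x : Site d) (Λ Δ : Finset (Site d)) :
    shiftSites x Λ ∩ shiftSites x Δ = shiftSites x (Λ ∩ Δ) := by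
  ext; simp [mem_shiftSites]

theorem shiftSites_nonempty {x : Site d} {Λ : Finset (Site d)} :
    (shiftSites x Λ).Nonempty ↔ Λ.Nonempty := Finset.image_nonempty

/-- Translation of finite sets of sites as a permutation. -/
def shiftSitesEquiv (x : Site d) : Finset (Site d) ≃ Finset (Site d) where
  toFun := shiftSites x
  invFun := shiftSites (-x)
  left_inv Λ := by rw [shiftSites_shiftSites, neg_add_cancel, shiftSites_zero]
  right_inv Λ := by rw [shiftSites_shiftSites, add_neg_cancel, shiftSites_zero]

theorem mem_box {n : ℕ} {x : Site d} : x ∈ box d n ↔ ∀ i, |x i| ≤ n := by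
  simp [box, abs_le]

theorem box_mono {m n : ℕ} (h : m ≤ n) : box d m ⊆ box d n := fun x hx => by
  rw [mem_box] at hx ⊢
  exact fun i => (hx i).trans (by exact_mod_cast h)

theorem card_box (n : ℕ) : (box d n).card = (2 * n + 1) ^ d := by
  simp only [box, Fintype.card_piFinset, Int.card_Icc, Finset.prod_const, Finset.card_univ,
    Fintype.card_fin]
  congr 1
  omega

theorem exists_subset_box (Λ : Finset (Site d)) : ∃ n, Λ ⊆ box d n := by
  refine ⟨Λ.sup fun x => Finset.univ.sup fun i => (x i).natAbs, fun x hx => mem_box.2 fun i => ?_⟩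
  have h1 := Finset.le_sup (f := fun x : Site d => Finset.univ.sup fun i => (x i).natAbs) hx
  have h2 := Finset.le_sup (f := fun i => (x i).natAbs) (Finset.mem_univ i)
  rw [Int.abs_eq_natAbs]
  exact_mod_cast h2.trans h1

theorem tendsto_box_atTop : Tendsto (box d) atTop atTop :=
  tendsto_atTop.2 fun Λ => by
    obtain ⟨n, hn⟩ := exists_subset_box Λ
    filter_upwards [eventually_ge_atTop n] with m hm
    exact hn.trans (box_mono hm)

end Sites

/-! ### Tails of an absolutely summable interaction. -/

section Potential

variable {Φ : Finset (Site d) → Config d E → EReal}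

theorem IsShiftInvariantPotential.supNorm_shiftSites (hshift : IsShiftInvariantPotential Φ)
    (x : Site d) (A : Finset (Site d)) : supNorm (Φ (shiftSites x A)) = supNorm (Φ A) := by
  simp only [supNorm, hshift A x]
  exact (shift_surjective x).iSup_comp fun ω => (Φ A ω).abs

theorem interactionTail_eq (Λ Δ : Finset (Site d)) :
    interactionTail Φ Λ Δ =
      ∑' A : Finset (Site d), if (A ∩ Λ).Nonempty ∧ ¬ A ⊆ Δ then supNorm (Φ A) else 0 := by
  rw [interactionTail]
  refine (tsum_subtype {A : Finset (Site d) | (A ∩ Λ).Nonempty ∧ ¬ A ⊆ Δ}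
    (fun A => supNorm (Φ A))).trans (tsum_congr fun A => ?_)
  simp [Set.indicator]

theorem IsShiftInvariantPotential.interactionTail_shiftSites
    (hshift : IsShiftInvariantPotential Φ) (x : Site d) (Λ Δ : Finset (Site d)) :
    interactionTail Φ (shiftSites x Λ) (shiftSites x Δ) = interactionTail Φ Λ Δ := by
  rw [interactionTail_eq, interactionTail_eq, ← (shiftSitesEquiv x).tsum_eq]
  refine tsum_congr fun A => ?_
  simp only [shiftSitesEquiv, Equiv.coe_fn_mk, shiftSites_inter, shiftSites_nonempty,
    shiftSites_subset_iff, hshift.supNorm_shiftSites]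

theorem interactionTail_mono {Λ Λ' Δ Δ' : Finset (Site d)} (hΛ : Λ ⊆ Λ') (hΔ : Δ' ⊆ Δ) :
    interactionTail Φ Λ Δ ≤ interactionTail Φ Λ' Δ' := by
  rw [interactionTail_eq, interactionTail_eq]
  refine ENNReal.tsum_le_tsum fun A => ?_
  by_cases h : (A ∩ Λ).Nonempty ∧ ¬ A ⊆ Δ
  · rw [if_pos h, if_pos ⟨h.1.mono (Finset.inter_subset_inter_left hΛ), fun h' => h.2 (h'.trans hΔ)⟩]
  · simp [if_neg h]

theorem interactionTail_le_sum (Λ Δ : Finset (Site d)) :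
    interactionTail Φ Λ Δ ≤ ∑ x ∈ Λ, interactionTail Φ {x} Δ := by
  simp only [interactionTail_eq]
  rw [← Summable.tsum_finsetSum fun _ _ => ENNReal.summable]
  refine ENNReal.tsum_le_tsum fun A => ?_
  split_ifs with h
  · obtain ⟨x, hx⟩ := h.1
    rw [Finset.mem_inter] at hx
    refine le_trans ?_ (Finset.single_le_sum (fun _ _ => zero_le) hx.2)
    rw [if_pos ⟨⟨x, by simp [hx.1]⟩, h.2⟩]
  · exact zero_le

theorem interactionTail_singleton (hshift : IsShiftInvariantPotential Φ) (x : Site d)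
    (Δ : Finset (Site d)) :
    interactionTail Φ {x} Δ = interactionTail Φ {0} (shiftSites (-x) Δ) := by
  rw [← hshift.interactionTail_shiftSites (-x)]
  simp [shiftSites]

/-- Every A meeting {0} contains 0, so the tail is part of the sum in the summability hypothesis. -/
theorem interactionTail_zero_lt_top (hsum : IsAbsolutelySummable Φ) (Δ : Finset (Site d)) :
    interactionTail Φ {0} Δ < ⊤ := by
  refine lt_of_le_of_lt ?_ hsum
  rw [interactionTail_eq]
  refine le_trans ?_ (tsum_subtype {A : Finset (Site d) | 0 ∈ A} (fun A => supNorm (Φ A))).ge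
  refine ENNReal.tsum_le_tsum fun A => ?_
  split_ifs with h
  · have : (0 : Site d) ∈ A := by
      by_contra h0
      simp [Finset.inter_singleton_of_notMem h0] at h
    simp [Set.indicator, this]
  · exact zero_le

theorem interactionTail_lt_top (hshift : IsShiftInvariantPotential Φ)
    (hsum : IsAbsolutelySummable Φ) (Λ Δ : Finset (Site d)) : interactionTail Φ Λ Δ < ⊤ := by
  refine (interactionTail_le_sum Λ Δ).trans_lt (ENNReal.sum_lt_top.2 fun x _ => ?_)
  rw [interactionTail_singleton hshift]
  exact interactionTail_zero_lt_top hsum _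

theorem tendsto_interactionTail (hshift : IsShiftInvariantPotential Φ)
    (hsum : IsAbsolutelySummable Φ) (Λ : Finset (Site d)) :
    Tendsto (interactionTail Φ Λ) atTop (𝓝 0) := by
  have h := ENNReal.tendsto_tsum_compl_atTop_zero
    (f := fun A : Finset (Site d) => if (A ∩ Λ).Nonempty ∧ ¬ A ⊆ ∅ then supNorm (Φ A) else 0)
    (by rw [← interactionTail_eq]; exact (interactionTail_lt_top hshift hsum Λ ∅).ne)
  rw [ENNReal.tendsto_nhds_zero] at h ⊢
  intro ε hε
  obtain ⟨s, hs⟩ := (h ε hε).exists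
  -- Once Δ contains every member of the finite family s, a set not contained in Δ cannot belong to
  -- s.
  filter_upwards [eventually_ge_atTop (s.biUnion id)] with Δ hΔ
  refine le_trans ?_ hs
  rw [interactionTail_eq]
  refine le_trans ?_ (tsum_subtype {A : Finset (Site d) | A ∉ s} (fun A =>
    if (A ∩ Λ).Nonempty ∧ ¬ A ⊆ ∅ then supNorm (Φ A) else 0)).ge
  refine ENNReal.tsum_le_tsum fun A => ?_
  by_cases hA : (A ∩ Λ).Nonempty ∧ ¬ A ⊆ Δ
  · have h1 : A ∉ s := fun h' => hA.2 ((Finset.subset_biUnion_of_mem id h').trans hΔ)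
    have h2 : ¬ A ⊆ ∅ := fun h' => hA.2 (h'.trans (Finset.empty_subset _))
    rw [if_pos hA, Set.indicator_of_mem (by exact h1), if_pos ⟨hA.1, h2⟩]
  · simp [if_neg hA]

theorem tendsto_card_box_sub_div_card_box (k : ℕ) :
    Tendsto (fun n : ℕ => ((box d (n - k)).card : ℝ≥0∞) / (box d n).card) atTop (𝓝 1) := by
  -- The side lengths are 2(n − k) + 1 and 2n + 1, so for n ≥ k their ratio is 1 − 2k/(2n + 1).
  have h1 : Tendsto (fun n : ℕ => (1 - (2 * k : ℝ) / (2 * n + 1)) ^ d) atTop (𝓝 1) := by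
    have h2 : Tendsto (fun n : ℕ => (2 * n + 1 : ℝ)) atTop atTop :=
      tendsto_atTop_add_const_right _ _ (tendsto_natCast_atTop_atTop.const_mul_atTop two_pos)
    simpa using ((h2.const_div_atTop (2 * k : ℝ)).const_sub 1).pow d
  have h3 := (ENNReal.continuous_ofReal.tendsto _).comp h1
  rw [ENNReal.ofReal_one] at h3
  refine h3.congr' ?_
  filter_upwards [eventually_ge_atTop k] with n hn
  have hp : (0 : ℝ) < 2 * n + 1 := by positivity
  have h4 : (1 - (2 * k : ℝ) / (2 * n + 1)) = (2 * (n - k : ℕ) + 1 : ℝ) / (2 * n + 1) := by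
    rw [Nat.cast_sub hn]
    field_simp
    ring
  simp only [Function.comp_apply, h4, div_pow, card_box]
  rw [ENNReal.ofReal_div_of_pos (by positivity)]
  congr 1
  · rw [← ENNReal.ofReal_natCast]; push_cast; rfl
  · rw [← ENNReal.ofReal_natCast]; push_cast; rfl

theorem tendsto_card_box_sub_div (k : ℕ) :
    Tendsto (fun n : ℕ => (((box d n).card - (box d (n - k)).card : ℕ) : ℝ≥0∞) / (box d n).card)
      atTop (𝓝 0) := by
  have h := ENNReal.Tendsto.sub (tendsto_const_nhds (x := (1 : ℝ≥0∞)))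
    (tendsto_card_box_sub_div_card_box (d := d) k) (Or.inl ENNReal.one_ne_top)
  rw [tsub_self] at h
  refine h.congr fun n => ?_
  have hc : ((box d n).card : ℝ≥0∞) ≠ 0 := by simp [card_box]
  rw [ENNReal.natCast_sub, ENNReal.sub_div fun _ _ => hc, ENNReal.div_self hc (by simp)]

/-- The interaction of a box with its complement is of smaller order than the volume. -/
theorem tendsto_interactionTail_box_div (hshift : IsShiftInvariantPotential Φ)
    (hsum : IsAbsolutelySummable Φ) :
    Tendsto (fun n : ℕ => interactionTail Φ (box d n) (box d n) / (box d n).card)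
      atTop (𝓝 0) := by
  set T := interactionTail Φ {0} ∅ with hT
  have hTtop : T ≠ ⊤ := (interactionTail_zero_lt_top hsum _).ne
  -- Sites at depth at least k inside Δ_n see a translate of Δ_k around them and contribute at most
  -- ε_{{0},Δ_k}. Sites in the boundary layer contribute at most T, and their proportion tends to 0.
  have key : ∀ k n : ℕ, k ≤ n → interactionTail Φ (box d n) (box d n) / (box d n).card ≤
      interactionTail Φ {0} (box d k) +
        T * ((((box d n).card - (box d (n - k)).card : ℕ) : ℝ≥0∞) / (box d n).card) := by
    intro k n hkn
    refine ENNReal.div_le_of_le_mul ?_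
    have hc : ((box d n).card : ℝ≥0∞) ≠ 0 := by simp [card_box]
    rw [add_mul, mul_assoc, ENNReal.div_mul_cancel hc (by simp)]
    refine (interactionTail_le_sum _ _).trans ?_
    rw [← Finset.sum_sdiff (box_mono (Nat.sub_le n k) : box d (n - k) ⊆ box d n), add_comm]
    gcongr
    · calc ∑ x ∈ box d (n - k), interactionTail Φ {x} (box d n)
          ≤ ∑ x ∈ box d (n - k), interactionTail Φ {0} (box d k) := by
            refine Finset.sum_le_sum fun x hx => ?_
            rw [interactionTail_singleton hshift]
            refine interactionTail_mono subset_rfl fun y hy => ?_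
            rw [mem_shiftSites, mem_box]
            rw [mem_box] at hx hy
            intro i
            have h := (abs_add_le (y i) (x i)).trans (add_le_add (hy i) (hx i))
            simp only [sub_neg_eq_add, Pi.add_apply]
            omega
        _ ≤ _ := by
            rw [Finset.sum_const, nsmul_eq_mul, mul_comm]
            gcongr
            exact box_mono (Nat.sub_le n k)
    · calc ∑ x ∈ box d n \ box d (n - k), interactionTail Φ {x} (box d n)
          ≤ ∑ x ∈ box d n \ box d (n - k), T := by
            refine Finset.sum_le_sum fun x hx => ?_
            rw [interactionTail_singleton hshift]
            exact interactionTail_mono subset_rfl (Finset.empty_subset _)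
        _ = _ := by
            rw [Finset.sum_const, nsmul_eq_mul, mul_comm,
              Finset.card_sdiff_of_subset (box_mono (Nat.sub_le n k))]
  rw [ENNReal.tendsto_nhds_zero]
  intro ε hε
  have h2 : 0 < ε / 2 := ENNReal.half_pos hε.ne'
  obtain ⟨k, hk⟩ := (tendsto_box_atTop.eventually
    (ENNReal.tendsto_nhds_zero.1 (tendsto_interactionTail hshift hsum {0}) _ h2)).exists
  have h3 : Tendsto (fun n : ℕ => T * ((((box d n).card - (box d (n - k)).card : ℕ) : ℝ≥0∞) /
      (box d n).card)) atTop (𝓝 0) := by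
    simpa using ENNReal.Tendsto.const_mul (tendsto_card_box_sub_div (d := d) k) (Or.inr hTtop)
  filter_upwards [ENNReal.tendsto_nhds_zero.1 h3 _ h2, eventually_ge_atTop k] with n hn hkn
  calc _ ≤ _ := key k n hkn
    _ ≤ ε / 2 + ε / 2 := add_le_add hk hn
    _ = ε := ENNReal.add_halves ε

end Potential

/-! ### The Hamiltonian as a real-valued function -/

section Cylinder

variable [MeasurableSpace E]

theorem measurable_glue_cylinderEvents (Λ : Finset (Site d)) (ζ : Λ → E) :
    Measurable[cylinderEvents (X := fun _ : Site d => E) ((Λ : Set (Site d))ᶜ)]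
      (glue Λ ζ : Config d E → Config d E) := by
  refine @measurable_pi_lambda _ _ _ (_) _ _ fun x => ?_
  by_cases hx : x ∈ Λ
  · simp only [glue, hx, dif_pos]
    exact @measurable_const _ _ _ (_) _
  · simp only [glue, hx, dif_neg, not_false_iff]
    exact measurable_cylinderEvent_apply (by simpa using hx)

/-- A measurable function not depending on the coordinates in `Λ` is measurable with respect to
the events off `Λ`. -/
theorem measurable_cylinderEvents_compl {Y : Type*} [MeasurableSpace Y] [Nonempty E]
    {Λ : Finset (Site d)} {f : Config d E → Y} (hf : Measurable f)
    (h : ∀ ω ω' : Config d E, (∀ x ∉ Λ, ω x = ω' x) → f ω = f ω') :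
    Measurable[cylinderEvents (X := fun _ : Site d => E) ((Λ : Set (Site d))ᶜ)] f := by
  obtain ⟨ζ⟩ : Nonempty (Λ → E) := inferInstance
  -- Overwriting the coordinates in Λ by a fixed ζ leaves f unchanged and makes it visibly
  -- measurable off Λ.
  have : f = f ∘ glue Λ ζ := funext fun ω => h _ _ fun x hx => by simp [glue, hx]
  rw [this]
  exact hf.comp (measurable_glue_cylinderEvents Λ ζ)

/-- Events off `Λ` do not depend on the coordinates in `Λ`. -/
theorem mem_iff_of_measurableSet_cylinderEvents {Λ : Set (Site d)} {A : Set (Config d E)}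
    (hA : MeasurableSet[cylinderEvents (X := fun _ : Site d => E) Λ] A)
    {ω ω' : Config d E} (h : ∀ x ∈ Λ, ω x = ω' x) : ω ∈ A ↔ ω' ∈ A := by
  have hle : cylinderEvents (X := fun _ : Site d => E) Λ ≤
      MeasurableSpace.pi.comap Λ.domRestrict := by
    refine iSup₂_le fun x hx => ?_
    rintro _ ⟨s, hs, rfl⟩
    exact ⟨(fun ζ : Λ → E => ζ ⟨x, hx⟩) ⁻¹' s, measurable_pi_apply _ hs, rfl⟩
  obtain ⟨s, -, rfl⟩ := hle _ hA
  have : Λ.domRestrict ω = Λ.domRestrict ω' := funext fun x => h x x.2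
  simp only [Set.mem_preimage, this]

end Cylinder

/-! ### Energies, their bounds and their dependence on the configuration. -/

section Energy

variable {Φ : Finset (Site d) → Config d E → EReal}

theorem IsPotential.eq_of_eqOn [MeasurableSpace E] (hΦ : IsPotential Φ) {A : Finset (Site d)} {ω ω' : Config d E}
    (h : ∀ x ∈ A, ω x = ω' x) : Φ A ω = Φ A ω' :=
  ((mem_iff_of_measurableSet_cylinderEvents (hΦ.measurable A (measurableSet_singleton (Φ A ω))) h).1
    rfl).symm

variable (Φ) in
/-- The Hamiltonian as a real number. -/
def energy (Λ : Finset (Site d)) (ω : Config d E) : ℝ :=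
  ∑' A : Finset (Site d), if (A ∩ Λ).Nonempty then (Φ A ω).toReal else 0

variable (Φ) in
/-- The supremum norms of the interactions with `Λ`. -/
def interactionBound (Λ : Finset (Site d)) (A : Finset (Site d)) : ℝ≥0∞ :=
  if (A ∩ Λ).Nonempty then supNorm (Φ A) else 0

theorem tsum_interactionBound (Λ : Finset (Site d)) :
    ∑' A, interactionBound Φ Λ A = interactionTail Φ Λ ∅ := by
  rw [interactionTail_eq]
  refine tsum_congr fun A => ?_
  have : (A ∩ Λ).Nonempty → ¬ A ⊆ ∅ := fun h h' => by
    simp [Finset.subset_empty.1 h'] at h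
  unfold interactionBound
  by_cases h : (A ∩ Λ).Nonempty
  · rw [if_pos h, if_pos ⟨h, this h⟩]
  · rw [if_neg h, if_neg fun h' => h h'.1]

variable (hshift : IsShiftInvariantPotential Φ) (hsum : IsAbsolutelySummable Φ)

theorem abs_le_supNorm (f : Config d E → EReal) (ω : Config d E) : (f ω).abs ≤ supNorm f :=
  le_iSup (fun ω => (f ω).abs) ω

include hshift hsum

theorem tsum_interactionBound_ne_top (Λ : Finset (Site d)) :
    ∑' A, interactionBound Φ Λ A ≠ ⊤ := by
  rw [tsum_interactionBound]
  exact (interactionTail_lt_top hshift hsum Λ ∅).ne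

theorem supNorm_ne_top {A : Finset (Site d)} (hA : A.Nonempty) : supNorm (Φ A) ≠ ⊤ := by
  have := ENNReal.ne_top_of_tsum_ne_top (tsum_interactionBound_ne_top hshift hsum A) A
  simpa [interactionBound, hA] using this

/-- Nonemptiness is essential: summability controls, through translations, every nonempty A, but
says nothing about Φ_∅, which may be infinite. Sets meeting Λ are nonempty, so `energy` never meets
the default value of `toReal`. -/
theorem coe_toReal_potential {A : Finset (Site d)} (hA : A.Nonempty) (ω : Config d E) :
    ((Φ A ω).toReal : EReal) = Φ A ω := by
  have h := ne_top_of_le_ne_top (supNorm_ne_top hshift hsum hA) (abs_le_supNorm (Φ A) ω)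
  exact EReal.coe_toReal (fun h' => by simp [h'] at h) (fun h' => by simp [h'] at h)

theorem abs_toReal_potential_le {A : Finset (Site d)} (hA : A.Nonempty) (ω : Config d E) :
    |(Φ A ω).toReal| ≤ (supNorm (Φ A)).toReal := by
  have h := abs_le_supNorm (Φ A) ω
  rw [← coe_toReal_potential hshift hsum hA ω, EReal.abs_def] at h
  exact (ENNReal.ofReal_le_iff_le_toReal (supNorm_ne_top hshift hsum hA)).1 h

theorem norm_ite_potential_le (Λ A : Finset (Site d)) (ω : Config d E) :
    ‖if (A ∩ Λ).Nonempty then (Φ A ω).toReal else 0‖ ≤ (interactionBound Φ Λ A).toReal := by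
  unfold interactionBound
  split_ifs with h
  · exact abs_toReal_potential_le hshift hsum (h.mono Finset.inter_subset_left) ω
  · simp

theorem summable_energy (Λ : Finset (Site d)) (ω : Config d E) :
    Summable fun A : Finset (Site d) => if (A ∩ Λ).Nonempty then (Φ A ω).toReal else 0 :=
  Summable.of_norm_bounded (ENNReal.summable_toReal (tsum_interactionBound_ne_top hshift hsum Λ))
    fun A => norm_ite_potential_le hshift hsum Λ A ω

theorem hamiltonian_eq (Λ : Finset (Site d)) (ω : Config d E) :
    hamiltonian Φ Λ ω = energy Φ Λ ω := by
  -- The real sum is carried to `EReal` along the continuous additive embedding.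
  have h := (summable_energy hshift hsum Λ ω).hasSum.map
    (⟨⟨Real.toEReal, EReal.coe_zero⟩, EReal.coe_add⟩ : ℝ →+ EReal) continuous_coe_real_ereal
  have h2 : HasSum (Set.indicator {A : Finset (Site d) | (A ∩ Λ).Nonempty} fun A => Φ A ω)
      (energy Φ Λ ω : EReal) := by
    refine (congrArg (HasSum · _) (funext fun A => ?_)).mp h
    by_cases hA : (A ∩ Λ).Nonempty
    · simp [Set.indicator, hA, coe_toReal_potential hshift hsum (hA.mono Finset.inter_subset_left)]
    · simp [Set.indicator, hA]
  exact (hasSum_subtype_iff_indicator.2 h2).tsum_eq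

theorem abs_energy_le (Λ : Finset (Site d)) (ω : Config d E) :
    |energy Φ Λ ω| ≤ (interactionTail Φ Λ ∅).toReal := by
  rw [← tsum_interactionBound, ENNReal.tsum_toReal_eq fun A =>
    ENNReal.ne_top_of_tsum_ne_top (tsum_interactionBound_ne_top hshift hsum Λ) A]
  exact tsum_of_norm_bounded
    (ENNReal.summable_toReal (tsum_interactionBound_ne_top hshift hsum Λ)).hasSum
    fun A => norm_ite_potential_le hshift hsum Λ A ω

/-- Terms with A ⊆ Δ cancel; every other term changes by at most twice its supremum norm. -/
theorem energy_sub_le [MeasurableSpace E] (hΦ : IsPotential Φ) (Λ Δ : Finset (Site d)) {ω ω' : Config d E}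
    (h : ∀ x ∈ Δ, ω x = ω' x) :
    energy Φ Λ ω - energy Φ Λ ω' ≤ 2 * (interactionTail Φ Λ Δ).toReal := by
  have hne : ∑' A : Finset (Site d), (if (A ∩ Λ).Nonempty ∧ ¬ A ⊆ Δ then supNorm (Φ A) else 0) ≠ ⊤ := by
    rw [← interactionTail_eq]; exact (interactionTail_lt_top hshift hsum Λ Δ).ne
  rw [energy, energy, ← (summable_energy hshift hsum Λ ω).tsum_sub (summable_energy hshift hsum Λ ω'),
    interactionTail_eq, ENNReal.tsum_toReal_eq fun A => ENNReal.ne_top_of_tsum_ne_top hne A,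
    ← tsum_mul_left]
  refine Summable.tsum_le_tsum (fun A => ?_)
    ((summable_energy hshift hsum Λ ω).sub (summable_energy hshift hsum Λ ω'))
    ((ENNReal.summable_toReal hne).mul_left 2)
  by_cases hA : (A ∩ Λ).Nonempty
  · by_cases hAΔ : A ⊆ Δ
    · simp [hΦ.eq_of_eqOn fun x hx => h x (hAΔ hx)]
    · have h1 := abs_le.1 (abs_toReal_potential_le hshift hsum (hA.mono Finset.inter_subset_left) ω)
      have h2 := abs_le.1 (abs_toReal_potential_le hshift hsum (hA.mono Finset.inter_subset_left) ω')
      simp only [hA, hAΔ, if_true, not_false_iff, and_self]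
      linarith
  · simp [hA]

/-- The sets meeting Λ also meet Δ and cancel in the difference; those that remain avoid Λ and do
not see its coordinates. This is what makes the specification consistent. -/
theorem energy_sub_energy_congr [MeasurableSpace E] (hΦ : IsPotential Φ) {Λ Δ : Finset (Site d)} (hΛ : Λ ⊆ Δ)
    {ω ω' : Config d E} (h : ∀ x ∉ Λ, ω x = ω' x) :
    energy Φ Δ ω - energy Φ Λ ω = energy Φ Δ ω' - energy Φ Λ ω' := by
  simp only [energy]
  rw [← (summable_energy hshift hsum Δ ω).tsum_sub (summable_energy hshift hsum Λ ω),
    ← (summable_energy hshift hsum Δ ω').tsum_sub (summable_energy hshift hsum Λ ω')]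
  refine tsum_congr fun A => ?_
  by_cases hA : (A ∩ Λ).Nonempty
  · simp [hA, hA.mono (Finset.inter_subset_inter_left hΛ)]
  · rw [hΦ.eq_of_eqOn fun x hx => h x fun hx' => hA ⟨x, Finset.mem_inter.2 ⟨hx, hx'⟩⟩]

omit hsum in
theorem energy_shiftSites (x : Site d) (Λ : Finset (Site d)) (ω : Config d E) :
    energy Φ (shiftSites x Λ) ω = energy Φ Λ (shift x ω) := by
  rw [energy, energy, ← (shiftSitesEquiv x).tsum_eq]
  refine tsum_congr fun A => ?_
  simp only [shiftSitesEquiv, Equiv.coe_fn_mk, shiftSites_inter, shiftSites_nonempty, hshift A x ω]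

omit hshift hsum in
theorem measurable_energy [MeasurableSpace E] (hΦ : IsPotential Φ) (Λ : Finset (Site d)) :
    Measurable (energy Φ Λ) := by
  refine Measurable.tsum fun A => ?_
  by_cases hA : (A ∩ Λ).Nonempty
  · simp only [hA, if_true]
    exact ((hΦ.measurable A).mono cylinderEvents_le_pi le_rfl).ereal_toReal
  · simp only [hA, if_false]
    exact measurable_const

end Energy

/-! ### The Gibbs specification -/

/-- The Boltzmann weight as a function on the configuration space. -/
def weight (Φ : Finset (Site d) → Config d E → EReal) (Λ : Finset (Site d)) (ω : Config d E) :
    ℝ≥0∞ :=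
  ENNReal.ofReal (Real.exp (-energy Φ Λ ω))

section Specification

variable [MeasurableSpace E] {ρ : Measure E} [IsProbabilityMeasure ρ]
  {Φ : Finset (Site d) → Config d E → EReal}

theorem measurable_weight (hΦ : IsPotential Φ) (Λ : Finset (Site d)) : Measurable (weight Φ Λ) :=
  ((measurable_energy hΦ Λ).neg.exp).ennreal_ofReal

theorem measurable_glue (Λ : Finset (Site d)) (ω : Config d E) :
    Measurable fun ζ => glue Λ ζ ω :=
  -- `glue` is definitionally `Function.updateFinset`, so integrals over E^Λ are instances of
  -- `lmarginal`.
  measurable_updateFinset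

omit [IsProbabilityMeasure ρ] in
/-- A function not depending on the coordinates in `Λ` can be pulled out of the integral
over `Λ`. -/
theorem lmarginal_mul_left_of_dependsOn {Λ : Finset (Site d)} {f g : Config d E → ℝ≥0∞}
    (hg : Measurable g) (h : ∀ ω ω' : Config d E, (∀ x ∉ Λ, ω x = ω' x) → f ω = f ω') :
    lmarginal (fun _ => ρ) Λ (fun ω => f ω * g ω) =
      fun ω => f ω * lmarginal (fun _ => ρ) Λ g ω := by
  funext ω
  have hg' : Measurable fun ζ : Λ → E => g (Function.updateFinset ω Λ ζ) :=
    hg.comp measurable_updateFinset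
  rw [lmarginal, lmarginal, ← lintegral_const_mul _ hg']
  refine lintegral_congr fun ζ => ?_
  rw [h (Function.updateFinset ω Λ ζ) ω fun x hx => by simp [Function.updateFinset, hx]]

variable (hΦ : IsPotential Φ) (hshift : IsShiftInvariantPotential Φ)
  (hsum : IsAbsolutelySummable Φ)

include hshift hsum

omit [MeasurableSpace E] in
theorem boltzmann_eq (Λ : Finset (Site d)) (ω : Config d E) (ζ : Λ → E) :
    boltzmann Φ Λ ω ζ = weight Φ Λ (glue Λ ζ ω) := by
  rw [boltzmann, hamiltonian_eq hshift hsum, ← EReal.coe_neg, EReal.exp_coe, weight]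

omit [IsProbabilityMeasure ρ] in
theorem partitionFunction_eq (Λ : Finset (Site d)) (ω : Config d E) :
    partitionFunction ρ Φ Λ ω = lmarginal (fun _ => ρ) Λ (weight Φ Λ) ω := by
  simp only [partitionFunction, boltzmann_eq hshift hsum]
  rfl

omit [MeasurableSpace E] in
theorem le_weight (Λ : Finset (Site d)) (ω : Config d E) :
    ENNReal.ofReal (Real.exp (-(interactionTail Φ Λ ∅).toReal)) ≤ weight Φ Λ ω := by
  unfold weight
  gcongr
  exact (le_abs_self _).trans (abs_energy_le hshift hsum Λ ω)

omit [MeasurableSpace E] in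
theorem weight_le (Λ : Finset (Site d)) (ω : Config d E) :
    weight Φ Λ ω ≤ ENNReal.ofReal (Real.exp (interactionTail Φ Λ ∅).toReal) := by
  unfold weight
  gcongr
  exact (neg_le_abs _).trans (abs_energy_le hshift hsum Λ ω)

theorem partitionFunction_ne_zero (Λ : Finset (Site d)) (ω : Config d E) :
    partitionFunction ρ Φ Λ ω ≠ 0 := by
  have h : ENNReal.ofReal (Real.exp (-(interactionTail Φ Λ ∅).toReal)) ≤
      partitionFunction ρ Φ Λ ω := by
    rw [partitionFunction_eq hshift hsum, lmarginal]
    refine le_trans ?_ (lintegral_mono fun ζ => le_weight hshift hsum Λ _)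
    simp
  have h2 := Real.exp_pos (-(interactionTail Φ Λ ∅).toReal)
  exact ((ENNReal.ofReal_pos.2 h2).trans_le h).ne'

theorem partitionFunction_ne_top (Λ : Finset (Site d)) (ω : Config d E) :
    partitionFunction ρ Φ Λ ω ≠ ⊤ := by
  have h : partitionFunction ρ Φ Λ ω ≤
      ENNReal.ofReal (Real.exp (interactionTail Φ Λ ∅).toReal) := by
    rw [partitionFunction_eq hshift hsum, lmarginal]
    refine (lintegral_mono fun ζ => weight_le hshift hsum Λ _).trans ?_
    simp
  exact ne_top_of_le_ne_top ENNReal.ofReal_ne_top h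

include hΦ

omit [IsProbabilityMeasure ρ] in
theorem lintegral_gibbsSpecification (Λ : Finset (Site d)) (ω : Config d E)
    {f : Config d E → ℝ≥0∞} (hf : Measurable f) :
    ∫⁻ σ, f σ ∂(gibbsSpecification ρ Φ Λ ω) =
      (partitionFunction ρ Φ Λ ω)⁻¹ *
        lmarginal (fun _ => ρ) Λ (fun σ => weight Φ Λ σ * f σ) ω := by
  have hb : boltzmann Φ Λ ω = fun ζ => weight Φ Λ (glue Λ ζ ω) :=
    funext (boltzmann_eq hshift hsum Λ ω)
  have hw' : Measurable fun ζ => weight Φ Λ (glue Λ ζ ω) :=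
    (measurable_weight hΦ Λ).comp (measurable_glue Λ ω)
  have hf' : Measurable fun ζ => f (glue Λ ζ ω) := hf.comp (measurable_glue Λ ω)
  rw [gibbsSpecification, lintegral_smul_measure, lintegral_map hf (measurable_glue Λ ω), hb,
    lintegral_withDensity_eq_lintegral_mul _ hw' hf']
  rfl

omit [IsProbabilityMeasure ρ] in
theorem gibbsSpecification_apply (Λ : Finset (Site d)) (ω : Config d E)
    {A : Set (Config d E)} (hA : MeasurableSet A) :
    gibbsSpecification ρ Φ Λ ω A =
      (partitionFunction ρ Φ Λ ω)⁻¹ *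
        lmarginal (fun _ => ρ) Λ (fun σ => weight Φ Λ σ * A.indicator 1 σ) ω := by
  rw [← lintegral_gibbsSpecification hΦ hshift hsum Λ ω (measurable_one.indicator hA),
    lintegral_indicator_one hA]

theorem isProbabilityMeasure_gibbsSpecification (Λ : Finset (Site d)) (ω : Config d E) :
    IsProbabilityMeasure (gibbsSpecification ρ Φ Λ ω) := by
  constructor
  rw [gibbsSpecification_apply hΦ hshift hsum Λ ω MeasurableSet.univ]
  simp only [Set.indicator_univ, Pi.one_apply, mul_one]
  rw [← partitionFunction_eq hshift hsum, ENNReal.inv_mul_cancel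
    (partitionFunction_ne_zero hshift hsum Λ ω) (partitionFunction_ne_top hshift hsum Λ ω)]

theorem measurable_gibbsSpecification_apply (Λ : Finset (Site d)) {f : Config d E → ℝ≥0∞}
    (hf : Measurable f) :
    Measurable fun ω => ∫⁻ σ, f σ ∂(gibbsSpecification ρ Φ Λ ω) := by
  simp only [lintegral_gibbsSpecification hΦ hshift hsum Λ _ hf, partitionFunction_eq hshift hsum]
  exact ((measurable_weight hΦ Λ).lmarginal _).inv.mul
    (((measurable_weight hΦ Λ).mul hf).lmarginal _)

omit [IsProbabilityMeasure ρ] in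
theorem lintegral_gibbsSpecification_congr (Λ : Finset (Site d)) {f : Config d E → ℝ≥0∞}
    (hf : Measurable f) {ω ω' : Config d E} (h : ∀ x ∉ Λ, ω x = ω' x) :
    ∫⁻ σ, f σ ∂(gibbsSpecification ρ Φ Λ ω) = ∫⁻ σ, f σ ∂(gibbsSpecification ρ Φ Λ ω') := by
  simp only [lintegral_gibbsSpecification hΦ hshift hsum Λ _ hf, partitionFunction_eq hshift hsum]
  rw [lmarginal_congr _ _ h, lmarginal_congr _ _ h]

theorem measurable_gibbsSpecification (Λ : Finset (Site d)) :
    Measurable (gibbsSpecification ρ Φ Λ) :=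
  Measure.measurable_of_measurable_coe _ fun A hA => by
    simpa only [lintegral_indicator_one hA] using
      measurable_gibbsSpecification_apply (ρ := ρ) hΦ hshift hsum Λ (measurable_one.indicator hA)

theorem gibbsSpecification_consistent {Λ Δ : Finset (Site d)} (hΛ : Λ ⊆ Δ) (ω : Config d E)
    {f : Config d E → ℝ≥0∞} (hf : Measurable f) :
    ∫⁻ σ, ∫⁻ τ, f τ ∂(gibbsSpecification ρ Φ Λ σ) ∂(gibbsSpecification ρ Φ Δ ω) =
      ∫⁻ σ, f σ ∂(gibbsSpecification ρ Φ Δ ω) := by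
  rw [lintegral_gibbsSpecification hΦ hshift hsum Δ ω
      (measurable_gibbsSpecification_apply hΦ hshift hsum Λ hf),
    lintegral_gibbsSpecification hΦ hshift hsum Δ ω hf]
  congr 1
  have hw := measurable_weight hΦ Λ
  have hwf : Measurable fun σ => weight Φ Λ σ * f σ := hw.mul hf
  -- Integrating over Δ can begin with integrating over Λ, so equality of the Λ-marginals suffices.
  refine congrFun (lmarginal_eq_of_subset hΛ ((measurable_weight hΦ Δ).mul
    (measurable_gibbsSpecification_apply hΦ hshift hsum Λ hf))
    ((measurable_weight hΦ Δ).mul hf) ?_) ω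
  -- The ratio of the two Boltzmann weights does not depend on the coordinates in Λ, and neither
  -- does the γ_Λ-integral q. Both come out of the integral over Λ, where the remaining weight
  -- integrates to Z_Λ and cancels its inverse.
  let r : Config d E → ℝ≥0∞ := fun σ => ENNReal.ofReal (Real.exp (-(energy Φ Δ σ - energy Φ Λ σ)))
  have hwr : ∀ σ, weight Φ Δ σ = r σ * weight Φ Λ σ := fun σ => by
    simp only [weight, r]
    rw [← ENNReal.ofReal_mul (Real.exp_pos _).le, ← Real.exp_add]
    congr 2
    ring
  have hr : ∀ σ σ' : Config d E, (∀ x ∉ Λ, σ x = σ' x) → r σ = r σ' := fun σ σ' h => by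
    simp only [r]
    rw [energy_sub_energy_congr hshift hsum hΦ hΛ h]
  let q : Config d E → ℝ≥0∞ := fun σ => ∫⁻ τ, f τ ∂(gibbsSpecification ρ Φ Λ σ)
  have h1 : (fun σ => weight Φ Δ σ * q σ) = fun σ => (r σ * q σ) * weight Φ Λ σ := by
    funext σ; rw [hwr]; ring
  have h2 : (fun σ => weight Φ Δ σ * f σ) = fun σ => r σ * (weight Φ Λ σ * f σ) := by
    funext σ; rw [hwr]; ring
  change lmarginal _ Λ (fun σ => weight Φ Δ σ * q σ) = lmarginal _ Λ (fun σ => weight Φ Δ σ * f σ)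
  rw [h1, h2, lmarginal_mul_left_of_dependsOn hw fun σ σ' h => by
    rw [hr σ σ' h]
    exact congrArg _ (lintegral_gibbsSpecification_congr hΦ hshift hsum Λ hf h),
    lmarginal_mul_left_of_dependsOn hwf hr]
  funext σ
  simp only [q]
  rw [lintegral_gibbsSpecification hΦ hshift hsum Λ σ hf, mul_assoc, ← partitionFunction_eq hshift hsum]
  congr 1
  rw [mul_comm, ← mul_assoc, ENNReal.mul_inv_cancel
    (partitionFunction_ne_zero hshift hsum Λ σ) (partitionFunction_ne_top hshift hsum Λ σ), one_mul]

theorem isSpecification_gibbsSpecification [Nonempty E] :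
    IsSpecification (gibbsSpecification ρ Φ) where
  isProbabilityMeasure := isProbabilityMeasure_gibbsSpecification hΦ hshift hsum
  measurable Λ A hA := by
    simp only [← lintegral_indicator_one hA]
    exact measurable_cylinderEvents_compl
      (measurable_gibbsSpecification_apply hΦ hshift hsum Λ (measurable_one.indicator hA))
      fun ω ω' h => lintegral_gibbsSpecification_congr hΦ hshift hsum Λ
        (measurable_one.indicator hA) h
  proper Λ A hA ω := by
    have hA' : MeasurableSet A := cylinderEvents_le_pi _ hA
    rw [gibbsSpecification_apply hΦ hshift hsum Λ ω hA']
    simp only [mul_comm (weight Φ Λ _)]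
    rw [lmarginal_mul_left_of_dependsOn (measurable_weight hΦ Λ) fun σ σ' h => ?_]
    · simp only
      rw [← partitionFunction_eq hshift hsum, mul_left_comm, ENNReal.inv_mul_cancel
        (partitionFunction_ne_zero hshift hsum Λ ω) (partitionFunction_ne_top hshift hsum Λ ω),
        mul_one]
    · have := mem_iff_of_measurableSet_cylinderEvents hA (ω := σ) (ω' := σ')
        fun x hx => h x (by simpa using hx)
      by_cases h' : σ ∈ A
      · simp [Set.indicator, h', this.1 h']
      · simp [Set.indicator, h', mt this.2 h']
  consistent Λ Δ hΛ ω := by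
    ext A hA
    rw [Measure.bind_apply hA (measurable_gibbsSpecification hΦ hshift hsum Λ).aemeasurable]
    simp only [← lintegral_indicator_one hA]
    exact gibbsSpecification_consistent hΦ hshift hsum hΛ ω (measurable_one.indicator hA)

theorem isShiftInvariantSpec_gibbsSpecification :
    IsShiftInvariantSpec (gibbsSpecification ρ Φ) := by
  intro Λ x A hA ω
  have hs : ∀ y : Site d, Measurable (shift (E := E) y) := fun y =>
    measurable_pi_lambda _ fun z => measurable_pi_apply _
  rw [shift_image_eq_preimage, gibbsSpecification_apply hΦ hshift hsum _ _ hA,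
    gibbsSpecification_apply hΦ hshift hsum _ _ (hs _ hA), partitionFunction_eq hshift hsum,
    partitionFunction_eq hshift hsum]
  have key : ∀ f : Config d E → ℝ≥0∞, Measurable f →
      lmarginal (fun _ => ρ) (shiftSites x Λ) (fun σ => f (shift x σ)) ω =
        lmarginal (fun _ => ρ) Λ f (shift x ω) := fun f hf =>
    lmarginal_image (μ := fun _ : Site d => ρ) (add_left_injective x) Λ hf ω
  have hm : Measurable fun σ => weight Φ Λ σ * (shift (-x) ⁻¹' A).indicator 1 σ :=
    (measurable_weight hΦ Λ).mul (measurable_one.indicator (hs _ hA))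
  rw [← key _ (measurable_weight hΦ Λ), ← key _ hm]
  have h1 : ∀ σ, weight Φ (shiftSites x Λ) σ = weight Φ Λ (shift x σ) := fun σ => by
    rw [weight, weight, energy_shiftSites hshift]
  congr 2
  · simp only [← h1]
  · funext σ
    by_cases hσ : σ ∈ A
    · simp [Set.indicator, ← h1, shift_neg_shift, hσ]
    · simp [Set.indicator, ← h1, shift_neg_shift, hσ]

end Specification

/-! ### Max-entropy and domination -/

section MaxEntropy

variable {X : Type*} [MeasurableSpace X]

theorem ExpDominated.maxEntropy_le {D : ℝ≥0} {μ ν : Measure X} (h : ExpDominated D μ ν) :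
    maxEntropy μ ν ≤ ((D : ℝ≥0∞) : EReal) := by
  have hle : (⨅ (c : ℝ≥0) (_ : μ ≤ c • ν), (c : ℝ≥0∞)) ≤ ENNReal.ofReal (Real.exp D) :=
    iInf₂_le (Real.exp D).toNNReal h.le
  refine (ENNReal.log_monotone hle).trans ?_
  rw [ENNReal.log_ofReal_of_pos (Real.exp_pos _), Real.log_exp]
  rfl

/-- Testing μ ≤ cν on the whole space forces c ≥ 1. This excludes negative values of the logarithm
and supplies the lower bound when squeezing the diameters. -/
theorem maxEntropy_nonneg (μ ν : Measure X) [IsProbabilityMeasure μ] [IsProbabilityMeasure ν] :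
    0 ≤ maxEntropy μ ν := by
  rw [maxEntropy, ENNReal.zero_le_log_iff]
  refine le_iInf₂ fun c hc => ?_
  simpa using hc Set.univ

theorem maxDiam_le {D : ℝ≥0} {B : Set (Measure X)}
    (h : ∀ μ ∈ B, ∀ ν ∈ B, ExpDominated D μ ν) : maxDiam B ≤ ((D : ℝ≥0∞) : EReal) :=
  iSup₂_le fun μ hμ => iSup₂_le fun ν hν => (h μ hμ ν hν).maxEntropy_le

theorem maxDiam_nonneg {B : Set (Measure X)} {μ : Measure X} [IsProbabilityMeasure μ]
    (hμ : μ ∈ B) : 0 ≤ maxDiam B :=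
  (maxEntropy_nonneg μ μ).trans
    ((le_iSup₂ (f := fun ν (_ : ν ∈ B) => maxEntropy μ ν) μ hμ).trans
      (le_iSup₂ (f := fun μ (_ : μ ∈ B) => ⨆ (ν ∈ B), maxEntropy μ ν) μ hμ))

theorem continuous_strongTopology_apply {A : Set X} (hA : MeasurableSet A) :
    @Continuous _ _ (strongTopology X) _ fun μ : Measure X => μ A :=
  continuous_iInf_dom (i := A) (continuous_iInf_dom (i := hA) continuous_induced_dom)

theorem subset_strongClosure (B : Set (Measure X)) : B ⊆ strongClosure B :=
  @subset_closure _ (strongTopology X) B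

theorem ExpDominated.of_mem_strongClosure {D : ℝ≥0} {B : Set (Measure X)}
    (h : ∀ μ ∈ B, ∀ ν ∈ B, ExpDominated D μ ν) :
    ∀ μ ∈ strongClosure B, ∀ ν ∈ strongClosure B, ExpDominated D μ ν := by
  let _ := strongTopology X
  -- For fixed A the domination inequality is a closed condition in each measure separately, so the
  -- closure is taken in one argument at a time.
  have h1 : ∀ μ ∈ strongClosure B, ∀ ν ∈ B, ExpDominated D μ ν := fun μ hμ ν hν A hA => by
    have hc : IsClosed {μ : Measure X | μ A ≤ ENNReal.ofReal (Real.exp D) * ν A} :=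
      isClosed_le (continuous_strongTopology_apply hA) continuous_const
    exact closure_minimal (fun μ hμ => h μ hμ ν hν A hA) hc hμ
  intro μ hμ ν hν A hA
  have hc : IsClosed {ν : Measure X | μ A ≤ ENNReal.ofReal (Real.exp D) * ν A} :=
    isClosed_le continuous_const
      ((ENNReal.continuous_const_mul ENNReal.ofReal_ne_top).comp
        (continuous_strongTopology_apply hA))
  exact closure_minimal (fun ν hν => h1 μ hμ ν hν A hA) hc hν

theorem ExpDominated.bind {Y : Type*} [MeasurableSpace Y] {D : ℝ≥0} {μ μ' : Measure Y}
    [IsProbabilityMeasure μ] [IsProbabilityMeasure μ'] {κ : Y → Measure X} (hκ : Measurable κ)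
    {P : Y → Prop} (hμ : ∀ᵐ y ∂μ, P y) (hμ' : ∀ᵐ y ∂μ', P y)
    (h : ∀ y y', P y → P y' → ExpDominated D (κ y) (κ y')) :
    ExpDominated D (μ.bind κ) (μ'.bind κ) := by
  intro A hA
  rw [Measure.bind_apply hA hκ.aemeasurable, Measure.bind_apply hA hκ.aemeasurable,
    ← lintegral_const_mul' _ _ ENNReal.ofReal_ne_top]
  -- The pointwise bound is averaged first over y, then over y'; the side free of the variable is
  -- unchanged because both measures have mass one.
  have h1 : ∀ᵐ y' ∂μ', ∫⁻ y, κ y A ∂μ ≤ ENNReal.ofReal (Real.exp D) * κ y' A := by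
    filter_upwards [hμ'] with y' hy'
    calc ∫⁻ y, κ y A ∂μ ≤ ∫⁻ _, ENNReal.ofReal (Real.exp D) * κ y' A ∂μ :=
          lintegral_mono_ae (hμ.mono fun y hy => h y y' hy hy' A hA)
      _ = _ := by simp
  simpa using lintegral_mono_ae h1

theorem eq_of_forall_expDominated {μ ν : Measure X} [IsProbabilityMeasure ν] {D : ℕ → ℝ≥0}
    (hD : Tendsto D atTop (𝓝 0)) (h : ∀ n, ExpDominated (D n) μ ν)
    (h' : ∀ n, ExpDominated (D n) ν μ) : μ = ν := by
  have hlim : Tendsto (fun n => ENNReal.ofReal (Real.exp (D n))) atTop (𝓝 1) := by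
    have : Tendsto (fun n => Real.exp (D n)) atTop (𝓝 (Real.exp ((0 : ℝ≥0) : ℝ))) :=
      (Real.continuous_exp.tendsto _).comp ((NNReal.continuous_coe.tendsto _).comp hD)
    simpa [Function.comp_def] using (ENNReal.continuous_ofReal.tendsto _).comp this
  have key : ∀ {μ ν : Measure X}, (∀ n, ExpDominated (D n) μ ν) → ∀ A, MeasurableSet A →
      μ A ≤ ν A := fun {μ ν} h A hA => by
    have := ENNReal.Tendsto.mul_const (b := ν A) hlim (Or.inl one_ne_zero)
    rw [one_mul] at this
    exact ge_of_tendsto' this fun n => h n A hA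
  ext A hA
  exact le_antisymm (key h A hA) (key h' A hA)

end MaxEntropy

/-! ### Dependence of finite-volume Gibbs measures on the boundary condition -/

section Boundary

/-- Four times the interaction tail, as a nonnegative real number. -/
def boundaryOsc (Φ : Finset (Site d) → Config d E → EReal) (Λ Δ : Finset (Site d)) : ℝ≥0 :=
  (4 * interactionTail Φ Λ Δ).toNNReal

variable [MeasurableSpace E] {ρ : Measure E} {Φ : Finset (Site d) → Config d E → EReal}

theorem measurable_restrict_finset (Λ : Finset (Site d)) :
    Measurable (Λ.restrict : Config d E → Λ → E) :=
  measurable_pi_lambda _ fun _ => measurable_pi_apply _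

variable (hΦ : IsPotential Φ) (hshift : IsShiftInvariantPotential Φ)
  (hsum : IsAbsolutelySummable Φ)

include hshift hsum

omit [MeasurableSpace E] in
theorem coe_boundaryOsc (Λ Δ : Finset (Site d)) :
    (boundaryOsc Φ Λ Δ : ℝ≥0∞) = 4 * interactionTail Φ Λ Δ :=
  ENNReal.coe_toNNReal (ENNReal.mul_ne_top (by simp) (interactionTail_lt_top hshift hsum Λ Δ).ne)

omit [MeasurableSpace E] in
theorem boundaryOsc_eq (Λ Δ : Finset (Site d)) :
    (boundaryOsc Φ Λ Δ : ℝ) = 4 * (interactionTail Φ Λ Δ).toReal := by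
  rw [← ENNReal.coe_toReal, coe_boundaryOsc hshift hsum, ENNReal.toReal_mul]
  rfl

omit [MeasurableSpace E] in
theorem boundaryOsc_mono {Λ Λ' Δ Δ' : Finset (Site d)} (hΛ : Λ ⊆ Λ') (hΔ : Δ' ⊆ Δ) :
    boundaryOsc Φ Λ Δ ≤ boundaryOsc Φ Λ' Δ' := by
  rw [← ENNReal.coe_le_coe, coe_boundaryOsc hshift hsum, coe_boundaryOsc hshift hsum]
  gcongr
  exact interactionTail_mono hΛ hΔ

omit [MeasurableSpace E] hsum in
theorem boundaryOsc_shiftSites (x : Site d) (Λ Δ : Finset (Site d)) :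
    boundaryOsc Φ (shiftSites x Λ) (shiftSites x Δ) = boundaryOsc Φ Λ Δ := by
  rw [boundaryOsc, boundaryOsc, hshift.interactionTail_shiftSites]

omit [MeasurableSpace E] in
theorem tendsto_boundaryOsc_box (Λ : Finset (Site d)) :
    Tendsto (fun n => boundaryOsc Φ Λ (box d n)) atTop (𝓝 0) := by
  have h := ENNReal.Tendsto.const_mul (a := 4)
    ((tendsto_interactionTail hshift hsum Λ).comp tendsto_box_atTop) (Or.inr (by simp))
  rw [mul_zero] at h
  exact (ENNReal.tendsto_toNNReal ENNReal.zero_ne_top).comp h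

omit [MeasurableSpace E] in
theorem tendsto_boundaryOsc_box_div :
    Tendsto (fun n => (boundaryOsc Φ (box d n) (box d n) : ℝ≥0∞) / (box d n).card)
      atTop (𝓝 0) := by
  have h := ENNReal.Tendsto.const_mul (a := 4)
    (tendsto_interactionTail_box_div hshift hsum) (Or.inr (by simp))
  rw [mul_zero] at h
  refine h.congr fun n => ?_
  rw [coe_boundaryOsc hshift hsum, mul_div_assoc]

include hΦ

/-- Agreement is needed only on Δ \ Λ, since gluing overwrites Λ. For Δ = Λ the condition is empty,
so any two boundary conditions are compared. -/
theorem expDominated_finiteVolume (Λ Δ : Finset (Site d)) {ω ω' : Config d E}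
    (h : ∀ x ∈ Δ, x ∉ Λ → ω x = ω' x) :
    ExpDominated (boundaryOsc Φ Λ Δ) (finiteVolume (gibbsSpecification ρ Φ) Λ ω)
      (finiteVolume (gibbsSpecification ρ Φ) Λ ω') := by
  -- K bounds the change of the Boltzmann weight. It enters once through the numerator and once
  -- through 1/Z, whence 4ε in the exponent.
  set K := ENNReal.ofReal (Real.exp (2 * (interactionTail Φ Λ Δ).toReal)) with hK
  have hKK : ENNReal.ofReal (Real.exp (boundaryOsc Φ Λ Δ)) = K * K := by
    rw [boundaryOsc_eq hshift hsum, hK, ← ENNReal.ofReal_mul (Real.exp_pos _).le, ← Real.exp_add]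
    congr 2
    ring
  have hw : ∀ σ σ' : Config d E, (∀ x ∈ Δ, x ∉ Λ → σ x = σ' x) → ∀ ζ : Λ → E,
      weight Φ Λ (glue Λ ζ σ) ≤ K * weight Φ Λ (glue Λ ζ σ') := by
    intro σ σ' h ζ
    rw [weight, weight, hK, ← ENNReal.ofReal_mul (Real.exp_pos _).le, ← Real.exp_add]
    gcongr
    have := energy_sub_le hshift hsum hΦ Λ Δ (ω := glue Λ ζ σ') (ω' := glue Λ ζ σ) fun x hx => by
      by_cases hxΛ : x ∈ Λ
      · simp [glue, hxΛ]
      · simp [glue, hxΛ, h x hx hxΛ]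
    linarith
  intro B hB
  have hB' := measurable_restrict_finset Λ hB
  rw [finiteVolume, finiteVolume, Measure.map_apply (measurable_restrict_finset Λ) hB,
    Measure.map_apply (measurable_restrict_finset Λ) hB,
    gibbsSpecification_apply hΦ hshift hsum Λ _ hB', gibbsSpecification_apply hΦ hshift hsum Λ _ hB',
    hKK, partitionFunction_eq hshift hsum, partitionFunction_eq hshift hsum]
  have h1 : lmarginal (fun _ => ρ) Λ (fun σ => weight Φ Λ σ * (Λ.restrict ⁻¹' B).indicator 1 σ) ω ≤
      K * lmarginal (fun _ => ρ) Λ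
        (fun σ => weight Φ Λ σ * (Λ.restrict ⁻¹' B).indicator 1 σ) ω' := by
    rw [lmarginal, lmarginal, ← lintegral_const_mul' _ _ ENNReal.ofReal_ne_top]
    refine lintegral_mono fun ζ => ?_
    rw [← mul_assoc]
    refine mul_le_mul' (hw ω ω' h ζ) (le_of_eq ?_)
    have : Λ.restrict (glue Λ ζ ω) = Λ.restrict (glue Λ ζ ω') := by
      funext x; simp [glue]
    change Set.indicator _ _ (glue Λ ζ ω) = Set.indicator _ _ (glue Λ ζ ω')
    by_cases h' : Λ.restrict (glue Λ ζ ω') ∈ B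
    · simp [Set.indicator, this, h']
    · simp [Set.indicator, this, h']
  have h2 : lmarginal (fun _ => ρ) Λ (weight Φ Λ) ω' ≤
      K * lmarginal (fun _ => ρ) Λ (weight Φ Λ) ω := by
    rw [lmarginal, lmarginal, ← lintegral_const_mul' _ _ ENNReal.ofReal_ne_top]
    exact lintegral_mono fun ζ => hw ω' ω (fun x hx hx' => (h x hx hx').symm) ζ
  have hK0 : K ≠ 0 := (ENNReal.ofReal_pos.2 (Real.exp_pos _)).ne'
  have h3 : (lmarginal (fun _ => ρ) Λ (weight Φ Λ) ω)⁻¹ ≤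
      K * (lmarginal (fun _ => ρ) Λ (weight Φ Λ) ω')⁻¹ := by
    rw [← ENNReal.inv_le_inv, ENNReal.mul_inv (Or.inl hK0) (Or.inl ENNReal.ofReal_ne_top)] at h2
    calc _ = K * (K⁻¹ * (lmarginal (fun _ => ρ) Λ (weight Φ Λ) ω)⁻¹) := by
          rw [← mul_assoc, ENNReal.mul_inv_cancel hK0 ENNReal.ofReal_ne_top, one_mul]
      _ ≤ _ := by gcongr
  calc _ ≤ _ := mul_le_mul' h3 h1
    _ = _ := by ring

theorem measurable_finiteVolume [IsProbabilityMeasure ρ] (Λ : Finset (Site d)) :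
    Measurable (finiteVolume (gibbsSpecification ρ Φ) Λ) :=
  (Measure.measurable_map _ (measurable_restrict_finset Λ)).comp
    (measurable_gibbsSpecification hΦ hshift hsum Λ)

theorem isProbabilityMeasure_finiteVolume [IsProbabilityMeasure ρ] (Λ : Finset (Site d))
    (ω : Config d E) : IsProbabilityMeasure (finiteVolume (gibbsSpecification ρ Φ) Λ ω) :=
  have := isProbabilityMeasure_gibbsSpecification (ρ := ρ) hΦ hshift hsum Λ ω
  Measure.isProbabilityMeasure_map (measurable_restrict_finset Λ).aemeasurable

theorem expDominated_of_mem_finiteVolumeSet [IsProbabilityMeasure ρ] {Λ : Finset (Site d)}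
    {μ ν : Measure (Λ → E)} (hμ : μ ∈ finiteVolumeSet (gibbsSpecification ρ Φ) Λ)
    (hν : ν ∈ finiteVolumeSet (gibbsSpecification ρ Φ) Λ) :
    ExpDominated (boundaryOsc Φ Λ Λ) μ ν := by
  obtain ⟨μ, _, rfl⟩ := hμ
  obtain ⟨ν, _, rfl⟩ := hν
  exact ExpDominated.bind (P := fun _ => True) (measurable_finiteVolume hΦ hshift hsum Λ)
    (by simp) (by simp) fun ω ω' _ _ =>
      expDominated_finiteVolume hΦ hshift hsum Λ Λ fun x hx hx' => absurd hx hx'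

variable [StandardBorelSpace E]

theorem expDominated_of_mem_finiteVolumeSetNear [IsProbabilityMeasure ρ] {Λ Δ : Finset (Site d)}
    {ω : Config d E} {μ ν : Measure (Λ → E)}
    (hμ : μ ∈ finiteVolumeSetNear (gibbsSpecification ρ Φ) Λ Δ ω)
    (hν : ν ∈ finiteVolumeSetNear (gibbsSpecification ρ Φ) Λ Δ ω) :
    ExpDominated (boundaryOsc Φ Λ Δ) μ ν := by
  have key : ∀ μ : Measure (Config d E),
      μ.map Δ.restrict = Measure.dirac (Δ.restrict ω) → ∀ᵐ σ ∂μ, Δ.restrict σ = Δ.restrict ω := by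
    intro μ hμ
    refine ae_of_ae_map (measurable_restrict_finset Δ).aemeasurable
      (p := fun ζ => ζ = Δ.restrict ω) ?_
    -- The standard Borel structure makes singletons of E^Δ measurable, so a Dirac marginal fixes
    -- the configuration on Δ almost surely.
    rw [hμ, ae_dirac_iff (measurableSet_eq)]
  obtain ⟨μ, _, hμ, rfl⟩ := hμ
  obtain ⟨ν, _, hν, rfl⟩ := hν
  refine ExpDominated.bind (P := fun σ => Δ.restrict σ = Δ.restrict ω)
    (measurable_finiteVolume hΦ hshift hsum Λ) (key μ hμ) (key ν hν) fun σ σ' hσ hσ' =>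
      expDominated_finiteVolume hΦ hshift hsum Λ Δ fun x hx _ => ?_
  exact congrFun (hσ.trans hσ'.symm) ⟨x, hx⟩

omit [StandardBorelSpace E] in
theorem finiteVolume_mem_finiteVolumeSetNear [IsProbabilityMeasure ρ] (Λ Δ : Finset (Site d))
    (ω : Config d E) :
    finiteVolume (gibbsSpecification ρ Φ) Λ ω ∈
      finiteVolumeSetNear (gibbsSpecification ρ Φ) Λ Δ ω :=
  ⟨Measure.dirac ω, inferInstance, Measure.map_dirac' (measurable_restrict_finset Δ) ω,
    (Measure.dirac_bind (measurable_finiteVolume hΦ hshift hsum Λ) ω).symm⟩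

theorem maxDiam_strongClosure_le [IsProbabilityMeasure ρ] (Λ Δ : Finset (Site d))
    (ω : Config d E) :
    maxDiam (strongClosure (finiteVolumeSetNear (gibbsSpecification ρ Φ) Λ Δ ω)) ≤
      ((4 * interactionTail Φ Λ Δ : ℝ≥0∞) : EReal) := by
  rw [← coe_boundaryOsc hshift hsum]
  exact maxDiam_le (ExpDominated.of_mem_strongClosure fun μ hμ ν hν =>
    expDominated_of_mem_finiteVolumeSetNear hΦ hshift hsum hμ hν)

theorem continuityPoints_gibbsSpecification [IsProbabilityMeasure ρ] :
    continuityPoints (gibbsSpecification ρ Φ) = Set.univ := by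
  refine Set.eq_univ_of_forall fun ω Λ => ?_
  have hmem : ∀ Δ, finiteVolume (gibbsSpecification ρ Φ) Λ ω ∈
      strongClosure (finiteVolumeSetNear (gibbsSpecification ρ Φ) Λ Δ ω) := fun Δ =>
    subset_strongClosure _ (finiteVolume_mem_finiteVolumeSetNear hΦ hshift hsum Λ Δ ω)
  have := isProbabilityMeasure_finiteVolume (ρ := ρ) hΦ hshift hsum Λ ω
  refine Set.eq_singleton_iff_unique_mem.2 ⟨Set.mem_iInter.2 hmem, fun μ hμ => ?_⟩
  have hdom := fun n => ExpDominated.of_mem_strongClosure fun μ hμ ν hν =>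
    expDominated_of_mem_finiteVolumeSetNear (ρ := ρ) (Λ := Λ) (Δ := box d n) (ω := ω)
      hΦ hshift hsum hμ hν
  exact eq_of_forall_expDominated (tendsto_boundaryOsc_box hshift hsum Λ)
    (fun n => hdom n _ (Set.mem_iInter.1 hμ _) _ (hmem _))
    (fun n => hdom n _ (hmem _) _ (Set.mem_iInter.1 hμ _))

omit [StandardBorelSpace E] in
theorem isWeaklyDependent_gibbsSpecification [IsProbabilityMeasure ρ] :
    IsWeaklyDependent (gibbsSpecification ρ Φ) := by
  have hE : Nonempty E := nonempty_of_isProbabilityMeasure ρ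
  have hle : ∀ Λ, maxDiam (finiteVolumeSet (gibbsSpecification ρ Φ) Λ) ≤
      ((boundaryOsc Φ Λ Λ : ℝ≥0∞) : EReal) := fun Λ => maxDiam_le fun μ hμ ν hν =>
    expDominated_of_mem_finiteVolumeSet hΦ hshift hsum hμ hν
  refine ⟨isSpecification_gibbsSpecification hΦ hshift hsum,
    isShiftInvariantSpec_gibbsSpecification hΦ hshift hsum, ?_, fun Λ => (hle Λ).trans_lt ?_⟩
  · obtain ⟨ω⟩ : Nonempty (Config d E) := inferInstance
    have h1 := (continuous_coe_ennreal_ereal.tendsto _).comp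
      (tendsto_boundaryOsc_box_div hshift hsum)
    refine tendsto_of_tendsto_of_tendsto_of_le_of_le tendsto_const_nhds h1 (fun n => ?_) fun n => ?_
    · have := isProbabilityMeasure_finiteVolume (ρ := ρ) hΦ hshift hsum (box d n) ω
      refine EReal.div_nonneg (maxDiam_nonneg (μ := finiteVolume (gibbsSpecification ρ Φ) (box d n) ω) ?_) (by positivity)
      -- With Δ = ∅ the marginal constraint is vacuous and can be dropped.
      obtain ⟨μ, h, -, h'⟩ := finiteVolume_mem_finiteVolumeSetNear (ρ := ρ) hΦ hshift hsum (box d n) ∅ ω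
      exact ⟨μ, h, h'⟩
    · have hc : (box d n).card ≠ 0 := by simp [card_box]
      rw [EReal.div_le_iff_le_mul (by exact_mod_cast hc.bot_lt) (EReal.natCast_ne_top _)]
      refine (hle _).trans (le_of_eq ?_)
      have hcast : ((box d n).card : EReal) = (((box d n).card : ℝ≥0∞) : EReal) := by norm_cast
      rw [Function.comp_apply, hcast, ← EReal.coe_ennreal_mul,
        ENNReal.mul_div_cancel (by exact_mod_cast hc) (by simp)]
  · simp

end Boundary

/-! ### Relative entropy in finite volumes -/

section FiniteVolumeEntropy

open InformationTheory ProbabilityTheory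

variable [MeasurableSpace E]

theorem measurable_shift (x : Site d) : Measurable (shift (E := E) x) :=
  measurable_pi_lambda _ fun _ => measurable_pi_apply _

theorem IsShiftInvariant.map_shift {μ : Measure (Config d E)} (hμ : IsShiftInvariant μ)
    (x : Site d) : μ.map (shift x) = μ := by
  ext A hA
  rw [Measure.map_apply (measurable_shift x) hA, ← hμ (-x) A hA, shift_image_eq_preimage, neg_neg]

theorem entropyOn_mono {Λ Δ : Finset (Site d)} (h : Λ ⊆ Δ) (μ ν : Measure (Config d E))
    [IsProbabilityMeasure μ] [IsProbabilityMeasure ν] : entropyOn Λ μ ν ≤ entropyOn Δ μ ν := by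
  have hg : Measurable (Finset.restrict₂ (π := fun _ : Site d => E) h) :=
    measurable_pi_lambda _ fun _ => measurable_pi_apply _
  have := Measure.isProbabilityMeasure_map (μ := μ) (measurable_restrict_finset Δ).aemeasurable
  have := Measure.isProbabilityMeasure_map (μ := ν) (measurable_restrict_finset Δ).aemeasurable
  have key := klDiv_map_le (μ.map Δ.restrict) (ν.map Δ.restrict) hg
  rwa [Measure.map_map hg (measurable_restrict_finset Δ),
    Measure.map_map hg (measurable_restrict_finset Δ)] at key

theorem entropyOn_map_shift_le (x : Site d) (Λ : Finset (Site d)) (μ ν : Measure (Config d E))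
    [IsProbabilityMeasure μ] [IsProbabilityMeasure ν] :
    entropyOn Λ (μ.map (shift x)) (ν.map (shift x)) ≤ entropyOn (shiftSites x Λ) μ ν := by
  set g : (shiftSites x Λ → E) → Λ → E := fun ζ y => ζ ⟨y + x, add_mem_shiftSites.2 y.2⟩
  have hg : Measurable g := measurable_pi_lambda _ fun _ => measurable_pi_apply _
  have hΔ := measurable_restrict_finset (E := E) (shiftSites x Λ)
  have := Measure.isProbabilityMeasure_map (μ := μ) hΔ.aemeasurable
  have := Measure.isProbabilityMeasure_map (μ := ν) hΔ.aemeasurable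
  have key := klDiv_map_le (μ.map (shiftSites x Λ).restrict) (ν.map (shiftSites x Λ).restrict) hg
  rw [Measure.map_map hg hΔ, Measure.map_map hg hΔ] at key
  rw [entropyOn, Measure.map_map (measurable_restrict_finset Λ) (measurable_shift x),
    Measure.map_map (measurable_restrict_finset Λ) (measurable_shift x)]
  exact key

/-- The pair of restrictions of a configuration to `W` and `B`. -/
def restrictPair (W B : Finset (Site d)) (ω : Config d E) : (W → E) × (B → E) :=
  (W.restrict ω, B.restrict ω)

theorem measurable_restrictPair (W B : Finset (Site d)) :
    Measurable (restrictPair (E := E) W B) :=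
  (measurable_restrict_finset W).prodMk (measurable_restrict_finset B)

theorem klDiv_map_restrictPair_le (W B : Finset (Site d)) (μ ν : Measure (Config d E))
    [IsProbabilityMeasure μ] [IsProbabilityMeasure ν] :
    klDiv (μ.map (restrictPair W B)) (ν.map (restrictPair W B)) ≤ entropyOn (W ∪ B) μ ν := by
  set g : ((W ∪ B : Finset (Site d)) → E) → (W → E) × (B → E) := fun ζ =>
    (fun y => ζ ⟨y, Finset.mem_union_left _ y.2⟩, fun y => ζ ⟨y, Finset.mem_union_right _ y.2⟩)
  have hg : Measurable g := (measurable_pi_lambda _ fun _ => measurable_pi_apply _).prodMk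
    (measurable_pi_lambda _ fun _ => measurable_pi_apply _)
  have hΔ := measurable_restrict_finset (E := E) (W ∪ B)
  have := Measure.isProbabilityMeasure_map (μ := μ) hΔ.aemeasurable
  have := Measure.isProbabilityMeasure_map (μ := ν) hΔ.aemeasurable
  have key := klDiv_map_le (μ.map (W ∪ B).restrict) (ν.map (W ∪ B).restrict) hg
  rwa [Measure.map_map hg hΔ, Measure.map_map hg hΔ] at key

/-- Data processing in the reverse direction: the pair of restrictions determines the configuration
on W ∪ B, so passing to pairs loses no entropy. -/
theorem entropyOn_union_le (W B : Finset (Site d)) (μ ν : Measure (Config d E))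
    [IsProbabilityMeasure μ] [IsProbabilityMeasure ν] :
    entropyOn (W ∪ B) μ ν ≤ klDiv (μ.map (restrictPair W B)) (ν.map (restrictPair W B)) := by
  set g : (W → E) × (B → E) → (W ∪ B : Finset (Site d)) → E := fun ζ y =>
    if h : (y : Site d) ∈ W then ζ.1 ⟨y, h⟩
    else ζ.2 ⟨y, (Finset.mem_union.1 y.2).resolve_left h⟩ with hgdef
  have hg : Measurable g := by
    refine measurable_pi_lambda _ fun y => ?_
    by_cases h : (y : Site d) ∈ W
    · simp only [hgdef, h, dif_pos]
      exact (measurable_pi_apply _).comp measurable_fst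
    · simp only [hgdef, h, dif_neg, not_false_iff]
      exact (measurable_pi_apply _).comp measurable_snd
  have hJ := measurable_restrictPair (E := E) W B
  have := Measure.isProbabilityMeasure_map (μ := μ) hJ.aemeasurable
  have := Measure.isProbabilityMeasure_map (μ := ν) hJ.aemeasurable
  have key := klDiv_map_le (μ.map (restrictPair W B)) (ν.map (restrictPair W B)) hg
  have hcomp : g ∘ restrictPair W B = (W ∪ B).restrict := by
    funext ω y
    by_cases h : (y : Site d) ∈ W
    · simp [hgdef, restrictPair, h]
    · simp [hgdef, restrictPair, h]
  rwa [Measure.map_map hg hJ, Measure.map_map hg hJ, hcomp] at key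

end FiniteVolumeEntropy

/-! ### Approximate chain rule and superadditivity of the entropy. -/

section Gibbs

open InformationTheory ProbabilityTheory

variable [MeasurableSpace E] {ρ : Measure E} [IsProbabilityMeasure ρ]
  {Φ : Finset (Site d) → Config d E → EReal}

-- Since W avoids B, γ_B leaves the configuration on W untouched; the joint law on W and B is a
-- Dirac mass at ω_W times the finite-volume measure.
omit [IsProbabilityMeasure ρ] in
theorem gibbsSpecification_restrictPair {W B : Finset (Site d)} (hWB : Disjoint W B)
    (ω : Config d E) {S : Set ((W → E) × (B → E))} (hS : MeasurableSet S) :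
    gibbsSpecification ρ Φ B ω (restrictPair W B ⁻¹' S) =
      finiteVolume (gibbsSpecification ρ Φ) B ω (Prod.mk (W.restrict ω) ⁻¹' S) := by
  have hS' : MeasurableSet (Prod.mk (W.restrict ω) ⁻¹' S) := measurable_prodMk_left hS
  rw [finiteVolume, Measure.map_apply (measurable_restrict_finset B) hS', gibbsSpecification,
    Measure.smul_apply, Measure.smul_apply,
    Measure.map_apply (measurable_glue B ω) (measurable_restrictPair W B hS),
    Measure.map_apply (measurable_glue B ω) (measurable_restrict_finset B hS')]
  congr 2
  ext ζ
  have h1 : W.restrict (glue B ζ ω) = W.restrict ω := by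
    funext y
    simp [glue, Finset.disjoint_left.1 hWB y.2]
  have h2 : B.restrict (glue B ζ ω) = ζ := by
    funext y
    simp [glue]
  simp [restrictPair, h1, h2]

variable (hΦ : IsPotential Φ) (hshift : IsShiftInvariantPotential Φ)
  (hsum : IsAbsolutelySummable Φ)

include hΦ hshift hsum

variable (ρ) in
/-- The finite-volume Gibbs measures in `B`, as a kernel depending on the configuration in `W`
only. -/
def boundaryKernel (W B : Finset (Site d)) (ω₀ : Config d E) : Kernel (W → E) (B → E) where
  toFun η := finiteVolume (gibbsSpecification ρ Φ) B (glue W η ω₀)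
  measurable' := (measurable_finiteVolume hΦ hshift hsum B).comp (measurable_glue W ω₀)

instance (W B : Finset (Site d)) (ω₀ : Config d E) :
    IsMarkovKernel (boundaryKernel ρ hΦ hshift hsum W B ω₀) :=
  ⟨fun _ => isProbabilityMeasure_finiteVolume hΦ hshift hsum B _⟩

theorem compProd_boundaryKernel_apply (W B : Finset (Site d)) (ω₀ : Config d E)
    (μ : Measure (Config d E)) [IsProbabilityMeasure μ]
    {S : Set ((W → E) × (B → E))} (hS : MeasurableSet S) :
    ((μ.map W.restrict) ⊗ₘ boundaryKernel ρ hΦ hshift hsum W B ω₀) S =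
      ∫⁻ ω, finiteVolume (gibbsSpecification ρ Φ) B (glue W (W.restrict ω) ω₀)
        (Prod.mk (W.restrict ω) ⁻¹' S) ∂μ := by
  have := Measure.isProbabilityMeasure_map (μ := μ) (measurable_restrict_finset W).aemeasurable
  rw [Measure.compProd_apply hS, lintegral_map (Kernel.measurable_kernel_prodMk_left hS)
    (measurable_restrict_finset W)]
  rfl

theorem bind_map_restrictPair_apply {W B : Finset (Site d)} (hWB : Disjoint W B)
    (μ : Measure (Config d E)) {S : Set ((W → E) × (B → E))} (hS : MeasurableSet S) :
    (μ.bind (gibbsSpecification ρ Φ B)).map (restrictPair W B) S =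
      ∫⁻ ω, finiteVolume (gibbsSpecification ρ Φ) B ω (Prod.mk (W.restrict ω) ⁻¹' S) ∂μ := by
  rw [Measure.map_apply (measurable_restrictPair W B) hS,
    Measure.bind_apply (measurable_restrictPair W B hS)
      (measurable_gibbsSpecification hΦ hshift hsum B).aemeasurable]
  simp only [gibbsSpecification_restrictPair hWB _ hS]

theorem isProbabilityMeasure_bind_gibbsSpecification (Λ : Finset (Site d))
    (μ : Measure (Config d E)) [IsProbabilityMeasure μ] :
    IsProbabilityMeasure (μ.bind (gibbsSpecification ρ Φ Λ)) := by
  constructor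
  have := isProbabilityMeasure_gibbsSpecification (ρ := ρ) hΦ hshift hsum Λ
  rw [Measure.bind_apply MeasurableSet.univ
    (measurable_gibbsSpecification hΦ hshift hsum Λ).aemeasurable]
  simp

/-- γ_B depends on the whole exterior, so it is not a kernel from E^W. Filling the sites off W with
a reference configuration ω₀ makes it one; the true and the modified boundary conditions agree on W,
so the price is governed by ε_{B,W∪B}. -/
theorem expDominated_bind_compProd {W B : Finset (Site d)} (hWB : Disjoint W B)
    (ω₀ : Config d E) (μ : Measure (Config d E)) [IsProbabilityMeasure μ] :
    ExpDominated (boundaryOsc Φ B (W ∪ B))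
      ((μ.bind (gibbsSpecification ρ Φ B)).map (restrictPair W B))
      ((μ.map W.restrict) ⊗ₘ boundaryKernel ρ hΦ hshift hsum W B ω₀) := by
  intro S hS
  rw [bind_map_restrictPair_apply hΦ hshift hsum hWB μ hS,
    compProd_boundaryKernel_apply hΦ hshift hsum W B ω₀ μ hS,
    ← lintegral_const_mul' _ _ ENNReal.ofReal_ne_top]
  refine lintegral_mono fun ω => expDominated_finiteVolume hΦ hshift hsum B (W ∪ B)
    (fun x hx hxB => ?_) _ (measurable_prodMk_left hS)
  have hxW : x ∈ W := (Finset.mem_union.1 hx).resolve_right hxB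
  simp [glue, hxW]

theorem expDominated_compProd_bind {W B : Finset (Site d)} (hWB : Disjoint W B)
    (ω₀ : Config d E) (μ : Measure (Config d E)) [IsProbabilityMeasure μ] :
    ExpDominated (boundaryOsc Φ B (W ∪ B))
      ((μ.map W.restrict) ⊗ₘ boundaryKernel ρ hΦ hshift hsum W B ω₀)
      ((μ.bind (gibbsSpecification ρ Φ B)).map (restrictPair W B)) := by
  intro S hS
  rw [bind_map_restrictPair_apply hΦ hshift hsum hWB μ hS,
    compProd_boundaryKernel_apply hΦ hshift hsum W B ω₀ μ hS,
    ← lintegral_const_mul' _ _ ENNReal.ofReal_ne_top]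
  refine lintegral_mono fun ω => expDominated_finiteVolume hΦ hshift hsum B (W ∪ B)
    (fun x hx hxB => ?_) _ (measurable_prodMk_left hS)
  have hxW : x ∈ W := (Finset.mem_union.1 hx).resolve_right hxB
  simp [glue, hxW]

variable [StandardBorelSpace E]

/-- Chain rule inequality: the relative entropy with respect to a state `ν` satisfying the DLR
equation in `B` bounds the sum of the relative entropy off `B` and the relative entropy with
respect to the resampled field `μ γ_B`. -/
theorem entropyOn_add_entropyOn_bind_le {W B : Finset (Site d)} (hWB : Disjoint W B)
    (μ ν : Measure (Config d E)) [IsProbabilityMeasure μ] [IsProbabilityMeasure ν]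
    (hν : ν.bind (gibbsSpecification ρ Φ B) = ν) :
    entropyOn W μ ν + entropyOn (W ∪ B) μ (μ.bind (gibbsSpecification ρ Φ B)) ≤
      entropyOn (W ∪ B) μ ν + 2 * boundaryOsc Φ B (W ∪ B) := by
  have hE : Nonempty E := nonempty_of_isProbabilityMeasure ρ
  obtain ⟨ω₀⟩ : Nonempty (Config d E) := inferInstance
  set κ := boundaryKernel ρ hΦ hshift hsum W B ω₀
  have hJ := measurable_restrictPair (E := E) W B
  have hW := measurable_restrict_finset (E := E) W
  have := Measure.isProbabilityMeasure_map (μ := μ) hJ.aemeasurable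
  have := Measure.isProbabilityMeasure_map (μ := ν) hJ.aemeasurable
  have := Measure.isProbabilityMeasure_map (μ := μ) hW.aemeasurable
  have := Measure.isProbabilityMeasure_map (μ := ν) hW.aemeasurable
  have := isProbabilityMeasure_bind_gibbsSpecification (ρ := ρ) hΦ hshift hsum B μ
  have := Measure.isProbabilityMeasure_map
    (μ := μ.bind (gibbsSpecification ρ Φ B)) hJ.aemeasurable
  -- The DLR equation in B turns this into a bound on the joint law of ν itself.
  have hdom := expDominated_bind_compProd (ρ := ρ) hΦ hshift hsum hWB ω₀ ν
  rw [hν] at hdom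
  have hfst : (μ.map (restrictPair W B)).fst = μ.map W.restrict := by
    rw [Measure.fst, Measure.map_map measurable_fst hJ]
    rfl
  calc entropyOn W μ ν + entropyOn (W ∪ B) μ (μ.bind (gibbsSpecification ρ Φ B))
      ≤ klDiv (μ.map W.restrict) (ν.map W.restrict) +
          (klDiv (μ.map (restrictPair W B)) ((μ.map W.restrict) ⊗ₘ κ)
            + boundaryOsc Φ B (W ∪ B)) := by
        refine add_le_add le_rfl ((entropyOn_union_le W B _ _).trans ?_)
        exact klDiv_le_klDiv_add (expDominated_compProd_bind hΦ hshift hsum hWB ω₀ μ)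
    _ = klDiv (μ.map (restrictPair W B)) ((ν.map W.restrict) ⊗ₘ κ)
          + boundaryOsc Φ B (W ∪ B) := by
        rw [klDiv_compProd_right (μ.map (restrictPair W B)) (ν.map W.restrict) κ, hfst, add_assoc]
    _ ≤ (klDiv (μ.map (restrictPair W B)) (ν.map (restrictPair W B)) + boundaryOsc Φ B (W ∪ B))
          + boundaryOsc Φ B (W ∪ B) := by
        gcongr
        exact klDiv_le_klDiv_add hdom
    _ ≤ (entropyOn (W ∪ B) μ ν + boundaryOsc Φ B (W ∪ B)) + boundaryOsc Φ B (W ∪ B) := by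
        gcongr
        exact klDiv_map_restrictPair_le W B μ ν
    _ = _ := by rw [add_assoc, two_mul]

omit [StandardBorelSpace E] in
theorem IsShiftInvariant.bind_gibbsSpecification_shiftSites {μ : Measure (Config d E)}
    (hμ : IsShiftInvariant μ) (x : Site d) (Λ : Finset (Site d)) :
    (μ.bind (gibbsSpecification ρ Φ (shiftSites x Λ))).map (shift x) =
      μ.bind (gibbsSpecification ρ Φ Λ) := by
  have hm := fun Λ => measurable_gibbsSpecification (ρ := ρ) hΦ hshift hsum Λ
  ext A hA
  rw [Measure.map_apply (measurable_shift x) hA,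
    Measure.bind_apply (measurable_shift x hA) (hm _).aemeasurable,
    Measure.bind_apply hA (hm _).aemeasurable]
  conv_rhs => rw [← hμ.map_shift x]
  have hmA : Measurable fun ω => gibbsSpecification ρ Φ Λ ω A :=
    (Measure.measurable_coe hA).comp (hm Λ)
  rw [lintegral_map hmA (measurable_shift x)]
  refine lintegral_congr fun ω => ?_
  rw [isShiftInvariantSpec_gibbsSpecification hΦ hshift hsum Λ x _ (measurable_shift x hA),
    Set.image_preimage_eq _ (shift_surjective x)]

/-- Packing disjoint translates `V + x`, `x ∈ X`, of a volume `V ⊇ B`. -/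
theorem card_mul_entropyOn_le {B V : Finset (Site d)} (hBV : B ⊆ V) (X : Finset (Site d))
    (hX : (X : Set (Site d)).PairwiseDisjoint fun x => shiftSites x V)
    (μ ν : Measure (Config d E)) [IsProbabilityMeasure μ] [IsProbabilityMeasure ν]
    (hμ : IsShiftInvariant μ)
    (hν : ∀ x ∈ X, ν.bind (gibbsSpecification ρ Φ (shiftSites x B)) = ν) :
    X.card * entropyOn V μ (μ.bind (gibbsSpecification ρ Φ B)) ≤
      entropyOn (X.biUnion fun x => shiftSites x V) μ ν +
        X.card * (2 * boundaryOsc Φ B V) := by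
  induction X using Finset.induction_on with
  | empty => simp
  | insert x X hx ih =>
    have ih' := ih (hX.subset (by simp)) fun y hy => hν y (Finset.mem_insert_of_mem hy)
    set U := X.biUnion fun x => shiftSites x V with hU
    set B' := shiftSites x B with hB'
    set V' := shiftSites x V with hV'
    have hB'V' : B' ⊆ V' := shiftSites_subset_iff.2 hBV
    have hUV : Disjoint U V' := by
      rw [hU, Finset.disjoint_biUnion_left]
      intro y hy
      refine hX (by simp [hy]) (by simp) fun h => hx (h ▸ hy)
    -- The chain rule is applied with the new translate of B resampled and all other sites,
    -- including V' \ B', placed in W. As U is disjoint from V' ⊇ B', this W still contains U.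
    have hunion : (insert x X).biUnion (fun x => shiftSites x V) = ((V' ∪ U) \ B') ∪ B' := by
      rw [Finset.biUnion_insert, Finset.sdiff_union_of_subset
        (hB'V'.trans Finset.subset_union_left)]
    have h1 := entropyOn_add_entropyOn_bind_le hΦ hshift hsum (W := (V' ∪ U) \ B') (B := B')
      Finset.sdiff_disjoint μ ν (hν x (Finset.mem_insert_self _ _))
    rw [← hunion] at h1
    have hsub : V' ⊆ (insert x X).biUnion fun x => shiftSites x V := by
      rw [Finset.biUnion_insert]; exact Finset.subset_union_left
    have h2 : entropyOn U μ ν ≤ entropyOn ((V' ∪ U) \ B') μ ν := by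
      refine entropyOn_mono (Finset.subset_sdiff.2 ⟨Finset.subset_union_right, ?_⟩) μ ν
      exact hUV.mono_right hB'V'
    have := isProbabilityMeasure_bind_gibbsSpecification (ρ := ρ) hΦ hshift hsum B' μ
    have h3 : entropyOn V μ (μ.bind (gibbsSpecification ρ Φ B)) ≤
        entropyOn ((insert x X).biUnion fun x => shiftSites x V) μ
          (μ.bind (gibbsSpecification ρ Φ B')) := by
      refine le_trans ?_ (entropyOn_mono hsub _ _)
      have := entropyOn_map_shift_le x V μ (μ.bind (gibbsSpecification ρ Φ B'))
      rwa [hμ.map_shift, hμ.bind_gibbsSpecification_shiftSites hΦ hshift hsum] at this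
    -- Enlarging the visible volume from V' to the whole union only shrinks the tail, and
    -- translation reduces it to B and V.
    have h4 : (boundaryOsc Φ B' ((insert x X).biUnion fun x => shiftSites x V) : ℝ≥0∞) ≤
        boundaryOsc Φ B V := by
      rw [← boundaryOsc_shiftSites hshift x B V]
      exact_mod_cast boundaryOsc_mono hshift hsum subset_rfl hsub
    rw [Finset.card_insert_of_notMem hx]
    push_cast
    rw [add_mul, add_mul, one_mul, one_mul]
    calc X.card * entropyOn V μ (μ.bind (gibbsSpecification ρ Φ B)) +
          entropyOn V μ (μ.bind (gibbsSpecification ρ Φ B))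
        ≤ (entropyOn U μ ν + X.card * (2 * boundaryOsc Φ B V)) + _ := add_le_add ih' h3
      _ ≤ (entropyOn ((V' ∪ U) \ B') μ ν + X.card * (2 * boundaryOsc Φ B V)) + _ := by gcongr
      _ ≤ (entropyOn ((insert x X).biUnion fun x => shiftSites x V) μ ν + 2 * boundaryOsc Φ B V)
          + X.card * (2 * boundaryOsc Φ B V) := by
        rw [add_right_comm]
        refine add_le_add (h1.trans ?_) le_rfl
        gcongr
      _ = _ := by ring

end Gibbs

/-! ### Specific free energy and the variational principle -/

section Packing

/-- A box is almost filled by disjoint translates of a smaller box. -/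
theorem exists_packing_box {m n : ℕ} (hmn : m ≤ n) :
    ∃ X : Finset (Site d),
      ((X : Set (Site d)).PairwiseDisjoint fun x => shiftSites x (box d m)) ∧
      (X.biUnion fun x => shiftSites x (box d m)) ⊆ box d n ∧
      (box d (n - (2 * m + 1))).card ≤ X.card * (box d m).card := by
  -- Translates by (2m + 1)z with z ∈ Δ_k tile a box of radius (2m + 1)k + m. This k is the largest
  -- for which that radius is at most n, so the radius exceeds n − (2m + 1) whenever this difference
  -- is not truncated.
  set k := (n - m) / (2 * m + 1)
  have hk : (2 * m + 1) * k ≤ n - m := Nat.mul_div_le _ _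
  have hk' : n - m < (2 * m + 1) * (k + 1) := Nat.lt_mul_div_succ _ (by omega)
  have hinj : Function.Injective fun z : Site d => (2 * (m : ℤ) + 1) • z :=
    smul_right_injective _ (by omega)
  refine ⟨(box d k).image fun z => (2 * (m : ℤ) + 1) • z, ?_, ?_, ?_⟩
  · rintro _ hx _ hy hxy
    simp only [Finset.coe_image, Set.mem_image] at hx hy
    obtain ⟨z, -, rfl⟩ := hx
    obtain ⟨w, -, rfl⟩ := hy
    refine Finset.disjoint_left.2 fun y h1 h2 => hxy ?_
    rw [mem_shiftSites, mem_box] at h1 h2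
    congr 1
    funext i
    have h1 := abs_le.1 (h1 i)
    have h2 := abs_le.1 (h2 i)
    simp only [Pi.sub_apply, Pi.smul_apply, smul_eq_mul] at h1 h2
    by_contra hne
    rcases lt_or_gt_of_ne hne with h | h
    · nlinarith [Int.add_one_le_iff.2 h]
    · nlinarith [Int.add_one_le_iff.2 h]
  · intro y hy
    simp only [Finset.mem_biUnion, Finset.mem_image] at hy
    obtain ⟨_, ⟨z, hz, rfl⟩, hy⟩ := hy
    rw [mem_shiftSites, mem_box] at hy
    rw [mem_box] at hz ⊢
    intro i
    have h1 := abs_le.1 (hy i)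
    have h2 := abs_le.1 (hz i)
    simp only [Pi.sub_apply, Pi.smul_apply, smul_eq_mul] at h1
    have h3 : (2 * (m : ℤ) + 1) * k + m ≤ n := by
      have : (2 * m + 1) * k + m ≤ n := by omega
      exact_mod_cast this
    rw [abs_le]
    constructor <;> nlinarith
  · rw [Finset.card_image_of_injective _ hinj, card_box, card_box, card_box, ← mul_pow]
    refine Nat.pow_le_pow_left ?_ d
    have : (2 * k + 1) * (2 * m + 1) = 2 * ((2 * m + 1) * k) + (2 * m + 1) := by ring
    rw [this]
    have : (2 * m + 1) * (k + 1) = (2 * m + 1) * k + (2 * m + 1) := by ring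
    omega

end Packing

/-! ### Existence of the specific free energy and the variational principle. -/

section Variational

variable [MeasurableSpace E] [StandardBorelSpace E] {ρ : Measure E}
  [IsProbabilityMeasure ρ] {Φ : Finset (Site d) → Config d E → EReal}
  (hΦ : IsPotential Φ) (hshift : IsShiftInvariantPotential Φ) (hsum : IsAbsolutelySummable Φ)

include hΦ hshift hsum

omit [StandardBorelSpace E] in
theorem bind_bind_gibbsSpecification {Λ Δ : Finset (Site d)} (h : Λ ⊆ Δ)
    (μ : Measure (Config d E)) :
    (μ.bind (gibbsSpecification ρ Φ Δ)).bind (gibbsSpecification ρ Φ Λ) =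
      μ.bind (gibbsSpecification ρ Φ Δ) := by
  have hE : Nonempty E := nonempty_of_isProbabilityMeasure ρ
  have hm := fun Λ => measurable_gibbsSpecification (ρ := ρ) hΦ hshift hsum Λ
  rw [Measure.bind_bind (hm Δ).aemeasurable (hm Λ).aemeasurable]
  exact congrArg _ (funext fun ω =>
    (isSpecification_gibbsSpecification hΦ hshift hsum).consistent Λ Δ h ω)

/-- The packing inequality is applied with ν = μγ_{Δ_n}, which by consistency satisfies the DLR
equation in every translate of B inside Δ_n. B is kept separate from Δ_m because B = Δ_m serves
existence of the limit, while a fixed B serves the variational principle. -/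
theorem entropyOn_div_card_le_liminf {B : Finset (Site d)} {m : ℕ} (hB : B ⊆ box d m)
    (μ : Measure (Config d E)) [IsProbabilityMeasure μ] (hμ : IsShiftInvariant μ) :
    entropyOn (box d m) μ (μ.bind (gibbsSpecification ρ Φ B)) / (box d m).card ≤
      liminf (fun n => entropyOn (box d n) μ (μ.bind (gibbsSpecification ρ Φ (box d n))) /
        (box d n).card) atTop + 2 * boundaryOsc Φ B (box d m) / (box d m).card := by
  set e := entropyOn (box d m) μ (μ.bind (gibbsSpecification ρ Φ B)) / (box d m).card
  set a := fun n => entropyOn (box d n) μ (μ.bind (gibbsSpecification ρ Φ (box d n))) /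
    ((box d n).card : ℝ≥0∞)
  set o : ℝ≥0∞ := 2 * boundaryOsc Φ B (box d m) / (box d m).card
  have hc : ∀ n, ((box d n).card : ℝ≥0∞) ≠ 0 := fun n => by simp [card_box]
  have hc' : ∀ n, ((box d n).card : ℝ≥0∞) ≠ ⊤ := fun n => ENNReal.natCast_ne_top _
  -- The prefactor bounds from below the proportion of Δ_n that is packed; it tends to 1 for fixed
  -- m.
  have key : ∀ᶠ n in atTop,
      ((box d (n - (2 * m + 1))).card : ℝ≥0∞) / (box d n).card * e ≤ a n + o := by
    filter_upwards [eventually_ge_atTop m] with n hmn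
    obtain ⟨X, hX, hXn, hcard⟩ := exists_packing_box (d := d) hmn
    have := isProbabilityMeasure_bind_gibbsSpecification (ρ := ρ) hΦ hshift hsum (box d n) μ
    have h1 := card_mul_entropyOn_le (ρ := ρ) hΦ hshift hsum hB X hX μ
      (μ.bind (gibbsSpecification ρ Φ (box d n))) hμ fun x hx =>
        bind_bind_gibbsSpecification hΦ hshift hsum ((shiftSites_subset_iff.2 hB).trans
          ((Finset.subset_biUnion_of_mem (fun x => shiftSites x (box d m)) hx).trans hXn)) μ
    have h2 := h1.trans (add_le_add_left (entropyOn_mono hXn μ _) _)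
    have hXcard : X.card * (box d m).card ≤ (box d n).card := by
      have := Finset.card_le_card hXn
      rwa [Finset.card_biUnion fun x hx y hy h => hX hx hy h,
        Finset.sum_congr rfl fun x _ => card_shiftSites x (box d m), Finset.sum_const,
        smul_eq_mul] at this
    have he : e * (box d m).card = entropyOn (box d m) μ (μ.bind (gibbsSpecification ρ Φ B)) :=
      ENNReal.div_mul_cancel (hc m) (hc' m)
    have ho : o * (box d m).card = 2 * boundaryOsc Φ B (box d m) :=
      ENNReal.div_mul_cancel (hc m) (hc' m)
    rw [mul_comm, ← mul_div_assoc]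
    refine ENNReal.div_le_of_le_mul ?_
    calc e * (box d (n - (2 * m + 1))).card ≤ e * ((X.card * (box d m).card : ℕ) : ℝ≥0∞) := by
          gcongr
      _ = X.card * entropyOn (box d m) μ (μ.bind (gibbsSpecification ρ Φ B)) := by
          rw [← he]; push_cast; ring
      _ ≤ _ := h2
      _ = a n * (box d n).card + ((X.card * (box d m).card : ℕ) : ℝ≥0∞) * o := by
          rw [← ho, ENNReal.div_mul_cancel (hc n) (hc' n)]; push_cast; ring
      _ ≤ a n * (box d n).card + (box d n).card * o := by gcongr
      _ = (a n + o) * (box d n).card := by ring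
  have hlim : Tendsto (fun n => ((box d (n - (2 * m + 1))).card : ℝ≥0∞) / (box d n).card * e)
      atTop (𝓝 e) := by
    simpa using ENNReal.Tendsto.mul_const (b := e)
      (tendsto_card_box_sub_div_card_box (d := d) (2 * m + 1)) (Or.inl one_ne_zero)
  rw [← hlim.liminf_eq]
  exact (liminf_le_liminf key).trans
    (liminf_add_const atTop a o (by isBoundedDefault) (by isBoundedDefault)).le

omit [StandardBorelSpace E] in
theorem entropyOn_bind_le_entropyOn_bind_add (Λ : Finset (Site d))
    (μ ν ν' : Measure (Config d E)) [IsProbabilityMeasure μ] [IsProbabilityMeasure ν]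
    [IsProbabilityMeasure ν'] :
    entropyOn Λ μ (ν.bind (gibbsSpecification ρ Φ Λ)) ≤
      entropyOn Λ μ (ν'.bind (gibbsSpecification ρ Φ Λ)) + boundaryOsc Φ Λ Λ := by
  have hr := measurable_restrict_finset (E := E) Λ
  have hm := measurable_gibbsSpecification (ρ := ρ) hΦ hshift hsum Λ
  have hbind : ∀ ν : Measure (Config d E), (ν.bind (gibbsSpecification ρ Φ Λ)).map Λ.restrict =
      ν.bind (finiteVolume (gibbsSpecification ρ Φ) Λ) := fun ν => by
    ext A hA
    rw [Measure.map_apply hr hA, Measure.bind_apply (hr hA) hm.aemeasurable,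
      Measure.bind_apply hA (measurable_finiteVolume hΦ hshift hsum Λ).aemeasurable]
    simp only [finiteVolume, Measure.map_apply hr hA]
  have := isProbabilityMeasure_bind_gibbsSpecification (ρ := ρ) hΦ hshift hsum Λ ν
  have := isProbabilityMeasure_bind_gibbsSpecification (ρ := ρ) hΦ hshift hsum Λ ν'
  have := Measure.isProbabilityMeasure_map (μ := μ) hr.aemeasurable
  have := Measure.isProbabilityMeasure_map (μ := ν.bind (gibbsSpecification ρ Φ Λ)) hr.aemeasurable
  have := Measure.isProbabilityMeasure_map (μ := ν'.bind (gibbsSpecification ρ Φ Λ)) hr.aemeasurable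
  refine klDiv_le_klDiv_add ?_
  rw [hbind, hbind]
  exact expDominated_of_mem_finiteVolumeSet hΦ hshift hsum ⟨ν', inferInstance, rfl⟩
    ⟨ν, inferInstance, rfl⟩

omit [StandardBorelSpace E] in
/-- The specific free energy does not depend on the boundary conditions. -/
theorem hasSFE_of_tendsto (μ : Measure (Config d E)) [IsProbabilityMeasure μ] {h : ℝ≥0∞}
    (hlim : Tendsto (fun n => entropyOn (box d n) μ (μ.bind (gibbsSpecification ρ Φ (box d n))) /
      ((box d n).card : ℝ≥0∞)) atTop (𝓝 h)) : HasSFE (gibbsSpecification ρ Φ) μ h := by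
  intro ν hν
  have ho := tendsto_boundaryOsc_box_div (Φ := Φ) hshift hsum
  have hup := hlim.add ho
  -- The limit h may be infinite; the subtraction is still continuous because the error tends to 0.
  have hlow := ENNReal.Tendsto.sub hlim ho (Or.inr ENNReal.zero_ne_top)
  rw [add_zero] at hup
  rw [tsub_zero] at hlow
  refine tendsto_of_tendsto_of_tendsto_of_le_of_le hlow hup (fun n => ?_) fun n => ?_
  · rw [tsub_le_iff_right, ← ENNReal.add_div]
    exact ENNReal.div_le_div_right
      (entropyOn_bind_le_entropyOn_bind_add hΦ hshift hsum (box d n) μ μ ν) _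
  · simp only
    rw [← ENNReal.add_div]
    exact ENNReal.div_le_div_right
      (entropyOn_bind_le_entropyOn_bind_add hΦ hshift hsum (box d n) μ ν μ) _

theorem exists_hasSFE (μ : Measure (Config d E)) [IsProbabilityMeasure μ]
    (hμ : IsShiftInvariant μ) : ∃ h, HasSFE (gibbsSpecification ρ Φ) μ h := by
  refine ⟨_, hasSFE_of_tendsto hΦ hshift hsum μ
    (tendsto_of_le_liminf_of_limsup_le le_rfl ?_)⟩
  set a := fun n => entropyOn (box d n) μ (μ.bind (gibbsSpecification ρ Φ (box d n))) /
    ((box d n).card : ℝ≥0∞)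
  have ho : Tendsto (fun m => liminf a atTop +
      2 * (boundaryOsc Φ (box d m) (box d m) : ℝ≥0∞) / (box d m).card) atTop
      (𝓝 (liminf a atTop)) := by
    have := (ENNReal.Tendsto.const_mul (a := 2) (tendsto_boundaryOsc_box_div (Φ := Φ) hshift hsum)
      (Or.inr (by simp))).const_add (liminf a atTop)
    simpa [mul_div_assoc] using this
  -- For B = Δ_m the error 2 · 4ε_{Δ_m,Δ_m} is o(|Δ_m|), so the limsup over m of the finite-volume
  -- bound is the liminf itself.
  rw [← ho.limsup_eq]
  exact limsup_le_limsup (Eventually.of_forall fun m =>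
    entropyOn_div_card_le_liminf hΦ hshift hsum subset_rfl μ hμ)

-- Zero entropy in a box identifies the marginals there and in every smaller volume, and a finite
-- measure on the product space is determined by its finite-dimensional marginals.
omit hΦ hshift hsum [StandardBorelSpace E] [IsProbabilityMeasure ρ] in
theorem eq_of_entropyOn_box_eq_zero {μ ν : Measure (Config d E)} [IsProbabilityMeasure μ]
    [IsProbabilityMeasure ν] (h : ∀ n, entropyOn (box d n) μ ν = 0) : μ = ν := by
  refine IsProjectiveLimit.unique (P := fun Λ : Finset (Site d) => μ.map Λ.restrict)
    (fun _ => rfl) fun Λ => ?_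
  obtain ⟨n, hn⟩ := exists_subset_box Λ
  have h0 : entropyOn Λ μ ν = 0 := le_antisymm ((entropyOn_mono hn μ ν).trans (h n).le) zero_le
  have := Measure.isProbabilityMeasure_map (μ := μ) (measurable_restrict_finset Λ).aemeasurable
  have := Measure.isProbabilityMeasure_map (μ := ν) (measurable_restrict_finset Λ).aemeasurable
  exact (InformationTheory.klDiv_eq_zero_iff.1 h0).symm

/-- The variational principle: vanishing specific free energy implies the DLR equations. -/
theorem bind_gibbsSpecification_eq_of_hasSFE_zero (μ : Measure (Config d E))
    [IsProbabilityMeasure μ] (hμ : IsShiftInvariant μ)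
    (h0 : HasSFE (gibbsSpecification ρ Φ) μ 0) (Λ : Finset (Site d)) :
    μ.bind (gibbsSpecification ρ Φ Λ) = μ := by
  have := isProbabilityMeasure_bind_gibbsSpecification (ρ := ρ) hΦ hshift hsum Λ μ
  refine (eq_of_entropyOn_box_eq_zero fun N => le_antisymm ?_ zero_le).symm
  obtain ⟨k, hk⟩ := exists_subset_box Λ
  have ho : Tendsto (fun m => 2 * (boundaryOsc Φ Λ (box d m) : ℝ≥0∞)) atTop (𝓝 0) := by
    simpa using ENNReal.Tendsto.const_mul (a := 2)
      (ENNReal.tendsto_coe.2 (tendsto_boundaryOsc_box (Φ := Φ) hshift hsum Λ)) (Or.inr (by simp))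
  -- The entropy in the fixed box Δ_N is bounded by that in each larger Δ_m. With zero free energy
  -- the volume |Δ_m| cancels, leaving 2 · 4ε_{Λ,Δ_m}, which vanishes as m grows because Λ is fixed.
  refine ge_of_tendsto ho ?_
  filter_upwards [eventually_ge_atTop N, eventually_ge_atTop k] with m hN hk'
  refine (entropyOn_mono (box_mono hN) μ _).trans ?_
  have h1 := entropyOn_div_card_le_liminf (ρ := ρ) hΦ hshift hsum (hk.trans (box_mono hk')) μ hμ
  rw [(h0 μ inferInstance).liminf_eq, zero_add] at h1
  have hc : ((box d m).card : ℝ≥0∞) ≠ 0 := by simp [card_box]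
  have hc' : ((box d m).card : ℝ≥0∞) ≠ ⊤ := ENNReal.natCast_ne_top _
  rwa [ENNReal.div_le_iff hc hc', ENNReal.div_mul_cancel hc hc'] at h1

omit [StandardBorelSpace E] in
theorem hasSFE_zero_of_mem_dlrStates {μ : Measure (Config d E)}
    (hμ : μ ∈ dlrStates (gibbsSpecification ρ Φ)) : HasSFE (gibbsSpecification ρ Φ) μ 0 := by
  have := hμ.1
  refine hasSFE_of_tendsto hΦ hshift hsum μ ?_
  have h : ∀ n, entropyOn (box d n) μ (μ.bind (gibbsSpecification ρ Φ (box d n))) = 0 := fun n => by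
    have := Measure.isProbabilityMeasure_map (μ := μ)
      (measurable_restrict_finset (box d n)).aemeasurable
    rw [hμ.2, entropyOn, InformationTheory.klDiv_self]
  simp [h]

theorem minimizers_gibbsSpecification :
    minimizers (gibbsSpecification ρ Φ) =
      {μ | μ ∈ dlrStates (gibbsSpecification ρ Φ) ∧ IsShiftInvariant μ} := by
  ext μ
  constructor
  · rintro ⟨hp, hμ, h0⟩
    exact ⟨⟨hp, bind_gibbsSpecification_eq_of_hasSFE_zero hΦ hshift hsum μ hμ h0⟩, hμ⟩
  · rintro ⟨hd, hμ⟩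
    exact ⟨hd.1, hμ, hasSFE_zero_of_mem_dlrStates hΦ hshift hsum hd⟩

end Variational

end RandomField

end

theorem mainTheorem12 (d : ℕ) {E : Type*} [MeasurableSpace E] [StandardBorelSpace E]
    (ρ : Measure E) [IsProbabilityMeasure ρ]
    (Φ : Finset (RandomField.Site d) → RandomField.Config d E → EReal)
    (hΦ : RandomField.IsPotential Φ)
    (hshift : RandomField.IsShiftInvariantPotential Φ)
    (hsum : RandomField.IsAbsolutelySummable Φ) :
    (∀ (Λ Δ : Finset (RandomField.Site d)) (ω : RandomField.Config d E),
      RandomField.maxDiam (RandomField.strongClosure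
          (RandomField.finiteVolumeSetNear (RandomField.gibbsSpecification ρ Φ) Λ Δ ω))
        ≤ ((4 * RandomField.interactionTail Φ Λ Δ : ℝ≥0∞) : EReal)) ∧
    RandomField.IsWeaklyDependent (RandomField.gibbsSpecification ρ Φ) ∧
    RandomField.continuityPoints (RandomField.gibbsSpecification ρ Φ) = Set.univ ∧
    (∀ μ : Measure (RandomField.Config d E), IsProbabilityMeasure μ →
      RandomField.IsShiftInvariant μ →
        ∃ h : ℝ≥0∞, RandomField.HasSFE (RandomField.gibbsSpecification ρ Φ) μ h) ∧
    RandomField.minimizers (RandomField.gibbsSpecification ρ Φ) =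
      {μ | μ ∈ RandomField.dlrStates (RandomField.gibbsSpecification ρ Φ) ∧
        RandomField.IsShiftInvariant μ} :=
  ⟨RandomField.maxDiam_strongClosure_le hΦ hshift hsum,
    RandomField.isWeaklyDependent_gibbsSpecification hΦ hshift hsum,
    RandomField.continuityPoints_gibbsSpecification hΦ hshift hsum,
    fun μ _ hμ => RandomField.exists_hasSFE hΦ hshift hsum μ hμ,
    RandomField.minimizers_gibbsSpecification hΦ hshift hsum⟩
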